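/- \textbf{Definitions.} A \emph{deterministic automaton with $n$ monitor counters} consists of a finite alphabet $\Sigma$, a finite set of states $Q$, an initial state $q_0$, a set $F\subseteq Q$ of accepting states and a transition function $\delta : Q\times\Sigma\to Q\times(\mathbb{Z}\cup\{s,t\})^n$ such that for every $(q,a)$ at most one of the $n$ instructions of $\delta(q,a)$ is $s$. Its \emph{run} on an infinite word $w=w_0w_1\dots\in\Sigma^\omega$ is a sequence $\pi=(q_i,u_i)_{i\ge 0}$ with $u_i\in(\mathbb{Z}\cup\{\bot\})^n$ such that $u_0=(\bot,\dots,\bot)$ and, if $\delta(q_i,w_i)=(q',v)$, then $q_{i+1}=q'$ and for every counter $j$: if $v[j]=s$ then $u_i[j]=\bot$ and $u_{i+1}[j]=0$; if $v[j]=t$ then $u_i[j]\in\mathbb{Z}$ and $u_{i+1}[j]=\bot$; if $v[j]\in\mathbb{Z}$ then $u_{i+1}[j]=u_i[j]+v[j]$ (with $\bot+z=\bot$). The run is \emph{accepting} if some state of $F$ occurs infinitely often, infinitely often some counter is activated (instruction $s$), and every activated counter is eventually terminated (instruction $t$); $w$ is \emph{accepted} if it has an accepting run. An accepting run assigns to each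 position at which a counter is activated the value that this counter has when it is next terminated; let $x_1,x_2,\dots$ be the infinite sequence of these integers, in the order of the positions of activation. For $f\in\{\mathrm{Sup},\mathrm{Inf},\mathrm{LimSup},\mathrm{LimInf}\}$, the \emph{$f$-automaton} $\mathcal{A}$ assigns to an accepted word $w$ the value $\mathcal{L}_{\mathcal{A}}(w)=f(x_1,x_2,\dots)\in\mathbb{R}\cup\{\pm\infty\}$, that is, the supremum, infimum, limit superior or limit inferior of the sequence, and to a word that is not accepted the value $\infty$ (the infimum over an empty set of runs). The \emph{emptiness problem}: given $\mathcal{A}$ and a threshold $\lambda\in\mathbb{Z}$, decide whether there is a word $w\in\Sigma^\omega$ with $\mathcal{L}_{\mathcal{A}}(w)\le\lambda$. The \emph{universality problem}: given $\mathcal{A}$ and $\lambda\in\mathbb{Z}$, decide whether every accepted word $w\in\Sigma^\omega$ satisfies $\mathcal{L}_{\mathcal{A}}(w)\le\lambda$. \textbf{Theorem.} \begin{enumerate} \item The emptiness problem is undecidable for deterministic $\mathrm{Sup}$-automata with $8$ monitor counters, and it is undecidable for deterministic $\mathrm{LimSup}$-automata with $8$ monitor counters. \item The universality problem is undecidable for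 deterministic $\mathrm{Inf}$-automata with $8$ monitor counters, and it is undecidable for deterministic $\mathrm{LimInf}$-automata with $8$ monitor counters. \end{enumerate} -/

import Mathlib

open Filter

/-- The instruction that a transition gives to one monitor counter: start it (`s`), terminate it
(`t`), or add an integer to it. -/
inductive CounterOp where
  | start : CounterOp
  | terminate : CounterOp
  | add : ℤ → CounterOp

/-- A finite automaton with `n` monitor counters, over the alphabet `Letter` and with the set of
states `State`. Each transition starts at most one counter. -/
structure MonitorAutomaton (Letter State : Type) (n : ℕ) where
  initial : Set State
  trans : Set (State × Letter × State × (Fin n → CounterOp))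
  trans_finite : trans.Finite
  start_unique : ∀ q a q' v, (q, a, q', v) ∈ trans →
    ∀ i j, v i = CounterOp.start → v j = CounterOp.start → i = j
  accepting : Set State

namespace MonitorAutomaton

variable {Letter State : Type} {n : ℕ}

/-- There is exactly one initial state, and the transition relation is the graph of a function from
`State × Letter` to `State × (Fin n → CounterOp)`. -/
def IsDeterministic (A : MonitorAutomaton Letter State n) : Prop :=
  (∃! q, q ∈ A.initial) ∧
    ∀ q a, ∃! p : State × (Fin n → CounterOp), (q, a, p.1, p.2) ∈ A.trans

/-- The effect of an instruction on the value of one counter; `none` is the value `⊥` of an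
inactive counter, and adding to an inactive counter leaves it inactive. -/
def CounterStep : CounterOp → Option ℤ → Option ℤ → Prop
  | .start, u, u' => u = none ∧ u' = some 0
  | .terminate, u, u' => u ≠ none ∧ u' = none
  | .add z, u, u' => u' = u.map (fun x => x + z)

/-- A configuration: a state together with the values of the counters. -/
abbrev Config (State : Type) (n : ℕ) : Type := State × (Fin n → Option ℤ)

/-- `π` is a run on the infinite word `w`; the letter `w i` leads from `π i` to `π (i + 1)`. -/
def IsRun (A : MonitorAutomaton Letter State n) (w : ℕ → Letter) (π : ℕ → Config State n) : Prop :=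
  ((π 0).1 ∈ A.initial ∧ ∀ j, (π 0).2 j = none) ∧
    ∀ i, ∃ v, ((π i).1, w i, (π (i + 1)).1, v) ∈ A.trans ∧
      ∀ j, CounterStep (v j) ((π i).2 j) ((π (i + 1)).2 j)

/-- Counter `j` is activated by the `i`-th transition of `π`. On a run this happens exactly when
the transition carries the instruction `start` for `j`, as no other instruction makes an inactive
counter active. -/
def Activated (π : ℕ → Config State n) (i : ℕ) (j : Fin n) : Prop :=
  (π i).2 j = none ∧ (π (i + 1)).2 j ≠ none

/-- An accepting run: some accepting state occurs infinitely often, infinitely often some counter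
is activated, and every activated counter is finally terminated. -/
def IsAccepting (A : MonitorAutomaton Letter State n) (w : ℕ → Letter)
    (π : ℕ → Config State n) : Prop :=
  A.IsRun w π ∧
    (∃ q ∈ A.accepting, ∃ᶠ i in atTop, (π i).1 = q) ∧
    (∃ᶠ i in atTop, ∃ j, Activated π i j) ∧
    (∀ i j, Activated π i j → ∃ k, i < k ∧ (π k).2 j ≠ none ∧ (π (k + 1)).2 j = none)

/-- Some counter `j` is activated by the `i`-th transition, and `x` is its value when it is
terminated for the first time after that. -/
def HasValueAt (π : ℕ → Config State n) (i : ℕ) (x : ℤ) : Prop :=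
  ∃ j k, Activated π i j ∧ i < k ∧ (∀ m, i < m → m ≤ k → (π m).2 j ≠ none) ∧
    (π k).2 j = some x ∧ (π (k + 1)).2 j = none

open Classical in
/-- The sequence of integers and `⊥ = none` that a run defines. -/
noncomputable def weights (π : ℕ → Config State n) (i : ℕ) : Option ℤ :=
  if h : ∃ x, HasValueAt π i x then some h.choose else none

end MonitorAutomaton

/-- The subsequence of the entries of `s` that are not silent (`none`), for a sequence `s` that has
infinitely many of them. -/
noncomputable def removeSilent (s : ℕ → Option ℤ) (k : ℕ) : ℤ :=
  (s (Nat.nth (fun i => (s i).isSome = true) k)).getD 0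

/-- Value functions on infinite sequences of integers. -/
abbrev ValueFunction : Type := (ℕ → ℤ) → EReal

namespace ValueFunction

noncomputable def Sup : ValueFunction := fun s => ⨆ k, ((s k : ℝ) : EReal)

noncomputable def Inf : ValueFunction := fun s => ⨅ k, ((s k : ℝ) : EReal)

noncomputable def LimSup : ValueFunction := fun s => limsup (fun k => ((s k : ℝ) : EReal)) atTop

noncomputable def LimInf : ValueFunction := fun s => liminf (fun k => ((s k : ℝ) : EReal)) atTop

end ValueFunction

namespace MonitorAutomaton

variable {Letter State : Type} {n : ℕ}

/-- The value of the word `w`: the infimum of the values of the accepting runs on `w`, which is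
`⊤` when there are none. -/
noncomputable def value (f : ValueFunction) (A : MonitorAutomaton Letter State n)
    (w : ℕ → Letter) : EReal :=
  ⨅ (π : ℕ → Config State n) (_ : A.IsAccepting w π), f (removeSilent (weights π))

/-- The word `w` has an accepting run. -/
def Accepts (A : MonitorAutomaton Letter State n) (w : ℕ → Letter) : Prop :=
  ∃ π, A.IsAccepting w π

/-- The question of the emptiness problem: some word has value at most `c`. -/
def Emptiness (f : ValueFunction) (A : MonitorAutomaton Letter State n) (c : ℤ) : Prop :=
  ∃ w, A.value f w ≤ ((c : ℝ) : EReal)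

/-- The question of the universality problem: no accepted word has a value greater than `c`. -/
def Universality (f : ValueFunction) (A : MonitorAutomaton Letter State n) (c : ℤ) : Prop :=
  ∀ w, A.Accepts w → A.value f w ≤ ((c : ℝ) : EReal)

end MonitorAutomaton

/-! Automata as inputs of algorithms: finite descriptions, coded by natural numbers. -/

def CounterOp.equivSum : CounterOp ≃ Bool ⊕ ℤ where
  toFun
    | .start => .inl true
    | .terminate => .inl false
    | .add z => .inr z
  invFun
    | .inl true => .start
    | .inl false => .terminate
    | .inr z => .add z
  left_inv o := by cases o <;> rfl
  right_inv o := by rcases o with (_ | _) | _ <;> rfl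

instance CounterOp.instPrimcodable : Primcodable CounterOp :=
  Primcodable.ofEquiv _ CounterOp.equivSum

/-- A finite description of an automaton with `n` monitor counters: the number of letters, the
number of states, and the lists of initial states, transitions and accepting states; letters and
states are given by their indices. -/
structure AutomatonDescription (n : ℕ) where
  letters : ℕ
  states : ℕ
  initial : List ℕ
  trans : List (ℕ × ℕ × ℕ × (Fin n → CounterOp))
  accepting : List ℕ

namespace AutomatonDescription

variable {n : ℕ}

def equivProd (n : ℕ) : AutomatonDescription n ≃
    ℕ × ℕ × List ℕ × List (ℕ × ℕ × ℕ × (Fin n → CounterOp)) × List ℕ where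
  toFun d := (d.letters, d.states, d.initial, d.trans, d.accepting)
  invFun p := ⟨p.1, p.2.1, p.2.2.1, p.2.2.2.1, p.2.2.2.2⟩
  left_inv _ := rfl
  right_inv _ := rfl

instance instPrimcodable (n : ℕ) : Primcodable (AutomatonDescription n) :=
  Primcodable.ofEquiv _ (equivProd n)

/-- The automaton that is described. Entries of the lists that mention an index out of range or
that start several counters at once are ignored, so that every description describes an automaton;
conversely every automaton over `Fin k` with the states `Fin m` is described by some `d`. -/
def toAutomaton (d : AutomatonDescription n) :
    MonitorAutomaton (Fin d.letters) (Fin d.states) n where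
  initial := {q | (q : ℕ) ∈ d.initial}
  trans := {t | ((t.1 : ℕ), (t.2.1 : ℕ), (t.2.2.1 : ℕ), t.2.2.2) ∈ d.trans ∧
    ∀ i j, t.2.2.2 i = CounterOp.start → t.2.2.2 j = CounterOp.start → i = j}
  trans_finite := by
    refine Set.Finite.subset (Set.Finite.preimage (f := fun t : Fin d.states × Fin d.letters ×
      Fin d.states × (Fin n → CounterOp) => ((t.1 : ℕ), (t.2.1 : ℕ), (t.2.2.1 : ℕ), t.2.2.2)) ?_
      (List.finite_toSet d.trans)) (fun t ht => ht.1)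
    rintro ⟨a, b, c, v⟩ _ ⟨a', b', c', v'⟩ _ h
    simpa [Fin.ext_iff] using h
  start_unique := fun _ _ _ _ h => h.2
  accepting := {q | (q : ℕ) ∈ d.accepting}

end AutomatonDescription

/-- The problem "given `a` with `promise a`, decide whether `question a` holds" is decidable: some
computable function answers it correctly on all inputs that satisfy the promise. -/
def DecidableProblem {α : Type} [Primcodable α] (promise question : α → Prop) : Prop :=
  ∃ f : α → Bool, Computable f ∧ ∀ a, promise a → (f a = true ↔ question a)

/-- The emptiness problem for deterministic `f`-automata with `n` monitor counters, given an
automaton and an integer threshold, is decidable. -/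
def EmptinessDecidable (f : ValueFunction) (n : ℕ) : Prop :=
  DecidableProblem (α := AutomatonDescription n × ℤ)
    (fun p => p.1.toAutomaton.IsDeterministic) (fun p => p.1.toAutomaton.Emptiness f p.2)

/-- The universality problem for deterministic `f`-automata with `n` monitor counters, given an
automaton and an integer threshold, is decidable. -/
def UniversalityDecidable (f : ValueFunction) (n : ℕ) : Prop :=
  DecidableProblem (α := AutomatonDescription n × ℤ)
    (fun p => p.1.toAutomaton.IsDeterministic) (fun p => p.1.toAutomaton.Universality f p.2)

/-! The halting problem of one fixed Turing machine, with varying input, reduces to all four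
problems. The halves of the tape are read as two natural numbers in base `b`; a machine step is
then, in each coordinate, an affine equation `mul * X + add = den * Y` under a finite control. A
halted machine passes to the rule `restart`, which discards the pair and writes the input again.
Hence the machine halts if and only if a chain of correct steps leads from `restart` back to
`restart` (`exists_ruleSystem_undecidable`).

The automaton reads blocks: a rule, then its pair in unary. Its states check the control. For each
coordinate, two counters of opposite signs compute `±(mul * X + add - den * Y)`, with `X` from one
block and `Y` from the next; consecutive computations overlap, whence 2 · 2 · 2 = 8 counters. If all
values are ≤ 0, or all are ≥ 0, then all vanish and the equations hold. Acceptance demands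
infinitely many uses of `restart`. So even a sign condition that holds only eventually, as LimSup
and LimInf provide, leaves two late uses of `restart` with a correct computation between them
(`exists_transGen_of_cfg`). Conversely, a halting computation closes up to a cycle, and the word
that repeats it forever has only values 0 (`exists_isAccepting_of_transGen`).

Thus halting is expressed by emptiness with threshold 0 and by failure of universality with
threshold -1 (`not_emptinessDecidable`, `not_universalityDecidable`). The input affects only integer
constants in the transitions, so the reduction is computable (`computable_description`). -/

/-! ### A fixed Turing machine with undecidable halting problem -/

open Turing in
/-- A Turing machine with finitely many reachable labels can be restricted to these labels. -/
theorem exists_tm0_restrict {Γ Λ : Type} [Inhabited Γ] [Inhabited Λ] (M : TM0.Machine Γ Λ)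
    (S : Finset Λ) (hS : TM0.Supports M (S : Set Λ)) :
    ∃ (_ : Inhabited S) (M' : TM0.Machine Γ S),
      ∀ l, (TM0.eval M' l).Dom ↔ (TM0.eval M l).Dom := by
  let inst : Inhabited S := ⟨⟨default, hS.1⟩⟩
  let M' : TM0.Machine Γ S := fun q a =>
    (M q a).pmap (fun p hp => (⟨p.1, hp⟩, p.2))
      (fun p hp => hS.2 hp q.2)
  refine ⟨inst, M', fun l => ?_⟩
  refine (StateTransition.tr_eval_dom (f₁ := TM0.step M') (f₂ := TM0.step M)
    (tr := fun c₁ c₂ => c₂ = ⟨c₁.q, c₁.Tape⟩) ?_ rfl).symm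
  rintro ⟨q, T⟩ _ rfl
  rcases h : M q T.head with _ | ⟨q', a⟩
  · have h' : M' q T.head = none := by simp [M', h]
    simp [TM0.step, h, h']
  · have hq : q' ∈ S := hS.2 h q.2
    have h' : M' q T.head = some (⟨q', hq⟩, a) := by simp [M', h]
    simp only [TM0.step, h', Option.map_some]
    exact ⟨_, rfl, Relation.TransGen.single (by simp [TM0.step, h])⟩

open Turing PartrecToTM2 in
theorem trNat_eq_cons (n : ℕ) (hn : n ≠ 0) :
    trNat n = (if n % 2 = 0 then Γ'.bit0 else Γ'.bit1) :: trNat (n / 2) := by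
  induction n using Nat.binaryRec with
  | zero => exact absurd rfl hn
  | bit b m _ =>
    have h2 : Nat.bit b m / 2 = m := Nat.bit_div_two b m
    rw [h2, trNat, trNat]
    cases b
    · have hm : m ≠ 0 := by rintro rfl; simp at hn
      have e : ((Nat.bit false m : ℕ) : Num) = Num.bit0 (m : Num) := by
        rw [← Num.bit0_of_bit0]; simp [Nat.bit, two_mul]
      rw [e]
      rcases h : (m : Num) with _ | p
      · exact absurd (by simpa [h] using (Num.to_of_nat m).symm) hm
      · simp [Num.bit0, trNum, trPosNum, Nat.bit]
    · have e : ((Nat.bit true m : ℕ) : Num) = Num.bit1 (m : Num) := by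
        rw [← Num.bit1_of_bit1]; simp [Nat.bit, two_mul]
      rw [e]
      have h3 : ¬ (Nat.bit true m % 2 = 0) := by simp [Nat.bit]
      rw [if_neg h3]
      rcases h : (m : Num) with _ | p <;> simp [Num.bit1, trNum, trPosNum]

-- Course-of-values recursion from `n / 2` to `n`, by `trNat_eq_cons`. Composing with `c` into a
-- coded type avoids coding the tape alphabet itself.
open Turing PartrecToTM2 in
theorem primrec_map_trNat {α : Type} [Primcodable α] (c : Γ' → α) :
    Primrec fun n => (trNat n).map c := by
  have key : Primrec₂ fun (_ : Unit) n => (trNat n).map c := by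
    -- The list `l` of earlier values has length `n`, so its length serves as the argument.
    refine Primrec.nat_strong_rec (fun (_ : Unit) n => (trNat n).map c)
      (g := fun _ l => if l.length = 0 then some [] else
        some ((if l.length % 2 = 0 then c Γ'.bit0 else c Γ'.bit1) :: l.getD (l.length / 2) [])) ?_ ?_
    · have hl : Primrec fun p : Unit × List (List α) => p.2.length :=
        Primrec.list_length.comp Primrec.snd
      refine Primrec.ite (Primrec.eq.comp hl (Primrec.const 0)) (Primrec.const _) ?_
      refine Primrec.option_some.comp (Primrec.list_cons.comp ?_ ?_)
      · exact Primrec.ite (Primrec.eq.comp (Primrec.nat_mod.comp hl (Primrec.const 2))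
          (Primrec.const 0)) (Primrec.const _) (Primrec.const _)
      · exact (Primrec.list_getD _).comp Primrec.snd (Primrec.nat_div.comp hl (Primrec.const 2))
    · intro _ n
      rcases eq_or_ne n 0 with rfl | hn
      · simp
      · have h : n / 2 < n := by omega
        rw [trNat_eq_cons n hn]
        simp only [List.length_map, List.length_range, hn, if_false]
        have : ((List.range n).map fun n => (trNat n).map c).getD (n / 2) []
            = (trNat (n / 2)).map c := by
          simp [List.getD, h]
        rw [this]
        split <;> simp
  exact key.comp (Primrec.const ()) Primrec.id

-- A universal function is used: the input is the index of a program, which is run on 0. The code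
-- stays fixed and only the input varies.
open Nat.Partrec Turing in
theorem exists_toPartrec_undecidable :
    ∃ c : ToPartrec.Code, ¬ ComputablePred fun n : ℕ => (c.eval [n]).Dom := by
  let f : ℕ →. ℕ := fun k => Code.eval (Denumerable.ofNat Code k) 0
  have hf : _root_.Partrec f :=
    Code.eval_part.comp (Computable.ofNat Code) (Computable.const 0)
  obtain ⟨c, hc⟩ := ToPartrec.Code.exists_code (Nat.Partrec'.part_iff₁.2 hf)
  refine ⟨c, fun h => ComputablePred.halting_problem 0 ?_⟩
  obtain ⟨g, hg, hgeq⟩ := ComputablePred.computable_iff.1 h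
  refine ComputablePred.computable_iff.2 ⟨fun k => g (Encodable.encode k),
    hg.comp Computable.encode, ?_⟩
  funext k
  rw [← congrFun hgeq (Encodable.encode k)]
  have := hc (Encodable.encode k ::ᵥ List.Vector.nil)
  simp only [List.Vector.cons_val] at this
  rw [show ([Encodable.encode k] : List ℕ)
    = (Encodable.encode k ::ᵥ List.Vector.nil).1 from rfl, hc]
  simp [f]

open Turing PartrecToTM2 in
/-- There is a fixed Turing machine whose halting problem is undecidable. -/
theorem exists_tm0_undecidable :
    ∃ (Γ Λ : Type) (_ : Inhabited Γ) (_ : Fintype Γ) (_ : Inhabited Λ) (_ : Fintype Λ)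
      (M : TM0.Machine Γ Λ) (s₀ : Γ) (u : ℕ → List Γ),
      (∀ c : Γ → ℕ, Primrec fun n => (u n).map c) ∧
        ¬ ComputablePred fun n => (TM0.eval M (s₀ :: u n)).Dom := by
  classical
  obtain ⟨c, hc⟩ := exists_toPartrec_undecidable
  let K'.fintype : Fintype K' := ⟨{K'.main, K'.rev, K'.aux, K'.stack}, fun k => by cases k <;> simp⟩
  -- The default label is the one in which a machine starts.
  let instΛ : Inhabited Λ' := ⟨trNormal c Cont'.halt⟩
  have hsupp := tr_supports c Cont'.halt
  have hsupp1 := TM2to1.tr_supports (M := tr) hsupp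
  have hsupp0 := TM1to0.tr_supports (M := TM2to1.tr tr) hsupp1
  obtain ⟨instS, M', hM'⟩ := exists_tm0_restrict _ _ hsupp0
  let g : Γ' → TM2to1.Γ' K' (fun _ => Γ') :=
    fun a => (false, Function.update (fun _ => none) K'.main (some a))
  refine ⟨TM2to1.Γ' K' (fun _ => Γ'), _, inferInstance, inferInstance, instS, inferInstance, M',
    (true, Function.update (fun _ => none) K'.main (some Γ'.cons)),
    fun n => (trNat n).reverse.map g, fun d => ?_, fun h => hc ?_⟩
  · have := Primrec.list_reverse.comp (primrec_map_trNat fun a => d (g a))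
    refine this.of_eq fun n => ?_
    simp
  · refine h.of_eq fun n => ?_
    rw [hM', TM1to0.tr_eval]
    -- The stack `trList [n]` lies on the tape from bottom to top, hence reversed; its bottom symbol
    -- `cons` carries the marker `true` and is the fixed first symbol.
    have : ((true, Function.update (fun _ => none) K'.main (some Γ'.cons)) ::
        (trNat n).reverse.map g : List (TM2to1.Γ' K' (fun _ => Γ')))
        = TM2to1.trInit K'.main (trList [n]) := by
      have hr : (trList [n]).reverse = Γ'.cons :: (trNat n).reverse := by simp [trList]
      unfold TM2to1.trInit
      rw [hr]
      rfl
    rw [this]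
    refine (TM2to1.tr_eval_dom _ _ _).trans ?_
    have e : (TM2.init K'.main (trList [n]) : TM2.Cfg (fun _ : K' => Γ') Λ' (Option Γ'))
        = PartrecToTM2.init c [n] := by
      simp only [TM2.init, PartrecToTM2.init]
      congr 1
      funext k
      cases k <;> simp [K'.elim]
    have e' : (TM2.eval tr K'.main (trList [n])).Dom
        ↔ (StateTransition.eval (TM2.step tr) (PartrecToTM2.init c [n])).Dom := by
      rw [← e]; rfl
    refine e'.trans ?_
    rw [tr_eval]
    rfl

/-! ### Turing machines as affine rules on pairs of natural numbers -/

/-- A finite control whose rules relate two natural numbers before and after the rule by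
affine equations. -/
structure RuleSystem (C R : Type) where
  src : R → C
  tgt : R → C
  mul : R → Bool → ℤ
  den : R → Bool → ℤ
  add : R → Bool → ℤ
  restart : R

namespace RuleSystem

variable {C R : Type}

def Step (P : RuleSystem C R) (r : R) (X Y : Bool → ℕ) : Prop :=
  ∀ x, P.mul r x * X x + P.add r x = P.den r x * Y x

/-- The rule `p.1` is applied to the pair `p.2`, and then the rule `p'.1` to the pair `p'.2`. -/
def Next (P : RuleSystem C R) (p p' : R × (Bool → ℕ)) : Prop :=
  P.tgt p.1 = P.src p'.1 ∧ P.Step p.1 p.2 p'.2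

end RuleSystem

namespace Turing

variable {Γ Λ : Type} [Inhabited Γ] [Inhabited Λ]

/-- The value of a half-infinite tape read as a number in base `b`. -/
def ListBlank.value (c : Γ → ℕ) (hc : c default = 0) (b : ℕ) (l : ListBlank Γ) : ℕ :=
  l.liftOn (fun l => Nat.ofDigits b (l.map c)) (by
    rintro l _ ⟨n, rfl⟩
    simp [Nat.ofDigits_append, hc, Nat.ofDigits_replicate_zero])

theorem ListBlank.value_mk (c : Γ → ℕ) (hc : c default = 0) (b : ℕ) (l : List Γ) :
    (ListBlank.mk l).value c hc b = Nat.ofDigits b (l.map c) := rfl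

theorem ListBlank.value_cons (c : Γ → ℕ) (hc : c default = 0) (b : ℕ) (s : Γ) (l : ListBlank Γ) :
    (l.cons s).value c hc b = c s + b * l.value c hc b := by
  induction l using ListBlank.induction_on with
  | h l => simp [ListBlank.cons_mk, ListBlank.value_mk, Nat.ofDigits_cons]

theorem ListBlank.value_eq (c : Γ → ℕ) (hc : c default = 0) (b : ℕ) (l : ListBlank Γ) :
    l.value c hc b = c l.head + b * l.tail.value c hc b := by
  rw [← ListBlank.value_cons, ListBlank.cons_head_tail]

def tapeValues (c : Γ → ℕ) (hc : c default = 0) (b : ℕ) (T : Tape Γ) (x : Bool) : ℕ :=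
  if x then T.right.value c hc b else T.left.value c hc b

/-- The rules that simulate a Turing machine on the values of the two halves of its tape; the
scanned symbol is part of the control. A rule `some (q, s, s')` is for the label `q`, the scanned
symbol `s` and the symbol `s'` scanned next. -/
def tmRules (M : TM0.Machine Γ Λ) (c : Γ → ℕ) (b : ℕ) (s₀ : Γ) (v : ℕ) :
    RuleSystem (Option (Λ × Γ)) (Option (Λ × Γ × Γ)) where
  src
    | none => none
    | some (q, s, _) => some (q, s)
  tgt
    | none => some (default, s₀)
    | some (q, s, s') => match M q s with
      | none => none
      | some (q', .write a) => some (q', a)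
      | some (q', .move _) => some (q', s')
  -- On a move, the scanned symbol becomes the lowest digit of the half that is left behind, and the
  -- half that is entered loses its lowest digit: `X - c s' = b * Y`. The factor 0 makes `restart`
  -- forget the pair.
  mul
    | none, _ => 0
    | some (q, s, _), x => match M q s with
      | some (_, .move .right) => if x then 1 else b
      | some (_, .move .left) => if x then b else 1
      | _ => 1
  den
    | none, _ => 1
    | some (q, s, _), x => match M q s with
      | some (_, .move .right) => if x then b else 1
      | some (_, .move .left) => if x then 1 else b
      | _ => 1
  add
    | none, x => if x then v else 0
    | some (q, s, s'), x => match M q s with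
      | some (_, .move .right) => if x then -c s' else c s
      | some (_, .move .left) => if x then c s else -c s'
      | _ => 0
  restart := none

variable {M : TM0.Machine Γ Λ} {c : Γ → ℕ} {hc : c default = 0} {b : ℕ} {s₀ : Γ} {v : ℕ}

theorem tmRules_step_of_step {e e' : TM0.Cfg Γ Λ} (h : e' ∈ TM0.step M e) :
    ∃ s, (tmRules M c b s₀ v).Step (some (e.q, e.Tape.head, s))
        (tapeValues c hc b e.Tape) (tapeValues c hc b e'.Tape) ∧
      (tmRules M c b s₀ v).tgt (some (e.q, e.Tape.head, s)) = some (e'.q, e'.Tape.head) := by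
  refine ⟨e'.Tape.head, ?_⟩
  obtain ⟨q, T⟩ := e
  simp only [TM0.step, Option.mem_def, Option.map_eq_some_iff] at h
  obtain ⟨⟨q', a⟩, h, rfl⟩ := h
  rcases a with (_ | _) | a
  · have := T.left.value_eq c hc b
    refine ⟨fun x => ?_, by simp [tmRules, h]⟩
    cases x <;> simp [tmRules, h, tapeValues, Tape.move, ListBlank.value_cons] <;> grind
  · have := T.right.value_eq c hc b
    refine ⟨fun x => ?_, by simp [tmRules, h]⟩
    cases x <;> simp [tmRules, h, tapeValues, Tape.move, ListBlank.value_cons] <;> grind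
  · refine ⟨fun x => ?_, by simp [tmRules, h, Tape.write]⟩
    cases x <;> simp [tmRules, h, tapeValues, Tape.write]

theorem tmRules_step_of_halted {e : TM0.Cfg Γ Λ} (h : TM0.step M e = none) (s : Γ) :
    (∀ X Y, (tmRules M c b s₀ v).Step (some (e.q, e.Tape.head, s)) X Y ↔ X = Y) ∧
      (tmRules M c b s₀ v).tgt (some (e.q, e.Tape.head, s)) = none := by
  obtain ⟨q, T⟩ := e
  simp only [TM0.step, Option.map_eq_none_iff] at h
  refine ⟨fun X Y => ?_, by simp [tmRules, h]⟩
  simp [RuleSystem.Step, tmRules, h, funext_iff]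

theorem eq_of_add_mul_eq {b x y s t : ℕ} (hs : s < b) (ht : t < b) (h : s + b * x = t + b * y) :
    s = t ∧ x = y := by
  have h1 : s = t := by
    have := congrArg (· % b) h
    simpa [Nat.mod_eq_of_lt hs, Nat.mod_eq_of_lt ht] using this
  subst h1
  exact ⟨rfl, Nat.eq_of_mul_eq_mul_left (by omega : 0 < b) (Nat.add_left_cancel h)⟩

/-- On a move the guess `s` is forced: the lowest digit in base `b` is unique, and `c` is injective.
On a write the guess plays no role. -/
theorem step_of_tmRules_step (hb : ∀ s, c s < b) (hinj : Function.Injective c)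
    {e : TM0.Cfg Γ Λ} {s : Γ} {Y : Bool → ℕ}
    (h : (tmRules M c b s₀ v).Step (some (e.q, e.Tape.head, s)) (tapeValues c hc b e.Tape) Y)
    (he : TM0.step M e ≠ none) :
    ∃ e' ∈ TM0.step M e, Y = tapeValues c hc b e'.Tape ∧
      (tmRules M c b s₀ v).tgt (some (e.q, e.Tape.head, s)) = some (e'.q, e'.Tape.head) := by
  obtain ⟨q, T⟩ := e
  simp only [TM0.step, ne_eq, Option.map_eq_none_iff] at he
  obtain ⟨⟨q', a⟩, h'⟩ := Option.ne_none_iff_exists'.1 he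
  have h0 := h false
  have h1 := h true
  simp only [TM0.step, h', Option.map_some, Option.mem_def, Option.some.injEq, exists_eq_left']
  rcases a with (_ | _) | a
  · have := T.left.value_eq c hc b
    simp [tmRules, h', tapeValues] at h0 h1
    have h2 : c T.left.head + b * T.left.tail.value c hc b = c s + b * Y false := by
      rw [← this]; zify; linarith
    obtain ⟨h3, h4⟩ := eq_of_add_mul_eq (hb _) (hb _) h2
    have h5 := hinj h3
    refine ⟨funext fun x => ?_, by simp [tmRules, h', Tape.move, h5]⟩
    cases x
    · simp [tapeValues, Tape.move, h4]
    · simp [tapeValues, Tape.move, ListBlank.value_cons]; zify; linarith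
  · have := T.right.value_eq c hc b
    simp [tmRules, h', tapeValues] at h0 h1
    have h2 : c T.right.head + b * T.right.tail.value c hc b = c s + b * Y true := by
      rw [← this]; zify; linarith
    obtain ⟨h3, h4⟩ := eq_of_add_mul_eq (hb _) (hb _) h2
    have h5 := hinj h3
    refine ⟨funext fun x => ?_, by simp [tmRules, h', Tape.move, h5]⟩
    cases x
    · simp [tapeValues, Tape.move, ListBlank.value_cons]; zify; linarith
    · simp [tapeValues, Tape.move, h4]
  · simp [tmRules, h', tapeValues] at h0 h1
    refine ⟨funext fun x => ?_, by simp [tmRules, h', Tape.write]⟩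
    cases x <;> simp [tapeValues, Tape.write, *]

/-- The entering pair `(r, Z)` is arbitrary so that the induction can peel off first steps; in the
application `r` is `restart`. -/
theorem tmRules_transGen_of_reaches {e d : TM0.Cfg Γ Λ} (h : StateTransition.Reaches (TM0.step M) e d)
    (hd : TM0.step M d = none) (r : Option (Λ × Γ × Γ)) (Z : Bool → ℕ)
    (hr : (tmRules M c b s₀ v).tgt r = some (e.q, e.Tape.head))
    (hZ : (tmRules M c b s₀ v).Step r Z (tapeValues c hc b e.Tape)) :
    Relation.TransGen (tmRules M c b s₀ v).Next (r, Z) (none, tapeValues c hc b d.Tape) := by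
  induction h using Relation.ReflTransGen.head_induction_on generalizing r Z with
  | refl =>
    have h := tmRules_step_of_halted (c := c) (b := b) (s₀ := s₀) (v := v) hd d.Tape.head
    exact .head (b := (some (d.q, d.Tape.head, d.Tape.head), tapeValues c hc b d.Tape)) ⟨hr, hZ⟩
      (.single ⟨h.2, (h.1 _ _).2 rfl⟩)
  | head h _ ih =>
    obtain ⟨s, h1, h2⟩ := tmRules_step_of_step (c := c) (hc := hc) (b := b) (s₀ := s₀) (v := v) h
    exact .head (b := (some (_, _, s), _)) ⟨hr, hZ⟩ (ih (some (_, _, s)) _ h2 h1)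

/-- If the machine ran forever, every pair reached from `restart` would encode one of its
configurations, with a control state `some _`. But the source of `restart` is `none`. -/
theorem halts_of_tmRules_transGen (hb : ∀ s, c s < b) (hinj : Function.Injective c)
    {e : TM0.Cfg Γ Λ} (he : e.q = default) (hs : e.Tape.head = s₀)
    (hv : tapeValues c hc b e.Tape = fun x => if x then v else 0) {X Y : Bool → ℕ}
    (h : Relation.TransGen (tmRules M c b s₀ v).Next (none, X) (none, Y)) :
    (StateTransition.eval (TM0.step M) e).Dom := by
  by_contra hdom
  have hne : ∀ d, StateTransition.Reaches (TM0.step M) e d → TM0.step M d ≠ none := fun d hd h0 =>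
    hdom (Part.dom_iff_mem.2 ⟨d, StateTransition.mem_eval.2 ⟨hd, h0⟩⟩)
  have hstart : ∀ Z W, (tmRules M c b s₀ v).Step none Z W → W = tapeValues c hc b e.Tape := by
    intro Z W hZ
    rw [hv]
    funext x
    have := hZ x
    cases x <;> simp [tmRules] at this ⊢ <;> omega
  have key : ∀ p, Relation.TransGen (tmRules M c b s₀ v).Next (none, X) p →
      ∃ d, StateTransition.Reaches (TM0.step M) e d ∧
        (tmRules M c b s₀ v).src p.1 = some (d.q, d.Tape.head) ∧ p.2 = tapeValues c hc b d.Tape := by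
    intro p hp
    induction hp with
    | single hp =>
      refine ⟨e, .refl, ?_, hstart _ _ hp.2⟩
      rw [← hp.1, he, hs]; rfl
    | @tail p p' _ hp ih =>
      obtain ⟨d, hd, h1, h2⟩ := ih
      obtain ⟨r, Z⟩ := p
      rcases r with _ | ⟨q, s, s'⟩
      · simp [tmRules] at h1
      · simp only [tmRules, Option.some.injEq, Prod.mk.injEq] at h1
        obtain ⟨rfl, rfl⟩ := h1
        obtain ⟨hp1, hp2⟩ := hp
        simp only at h2 hp1 hp2
        subst h2
        obtain ⟨d', hd', h3, h4⟩ := step_of_tmRules_step hb hinj hp2 (hne d hd)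
        exact ⟨d', hd.tail hd', by rw [← hp1, h4], h3⟩
  obtain ⟨d, _, h1, _⟩ := key _ h
  simp [tmRules] at h1

end Turing

/-! ### Undecidability of returning to `restart` -/

theorem primrec_natCast_int : Primrec fun n : ℕ => (n : ℤ) := by
  refine Primrec.encode_iff.1 ?_
  refine (Primrec.nat_mul.comp (Primrec.const 2) Primrec.id).of_eq fun n => ?_
  rfl

/-- Negative integers have odd codes: `-n` has the code `2 * n - 1`, and truncated subtraction
covers `n = 0`. -/
theorem primrec_neg_natCast_int : Primrec fun n : ℕ => -(n : ℤ) := by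
  refine Primrec.encode_iff.1 ?_
  refine (Primrec.nat_sub.comp (Primrec.nat_mul.comp (Primrec.const 2) Primrec.id)
    (Primrec.const 1)).of_eq fun n => ?_
  cases n <;> rfl

open Turing in
/-- A family of rule systems that differ only in two constants of the rule `restart`. For them it
is undecidable whether the rule `restart` can be used again after it has been used. -/
theorem exists_ruleSystem_undecidable :
    ∃ (C R : Type) (_ : Fintype R) (P : ℕ → RuleSystem C R) (D : ℕ → Prop),
      (∀ n, (P n).src = (P 0).src ∧ (P n).tgt = (P 0).tgt ∧ (P n).mul = (P 0).mul ∧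
        (P n).den = (P 0).den ∧ (P n).restart = (P 0).restart) ∧
      (∀ r x, (Computable fun n => (P n).add r x) ∧ Computable fun n => -(P n).add r x) ∧
      (∀ n, D n → ∃ X, Relation.TransGen (P n).Next ((P n).restart, X) ((P n).restart, X)) ∧
      (∀ n X Y, Relation.TransGen (P n).Next ((P n).restart, X) ((P n).restart, Y) → D n) ∧
      ¬ ComputablePred D := by
  classical
  obtain ⟨Γ, Λ, _, _, _, _, M, s₀, u, hu, hund⟩ := exists_tm0_undecidable
  -- The blank must be the digit 0, so that the infinite blank part of the tape contributes nothing.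
  let c : Γ → ℕ := fun s => if s = default then 0 else Fintype.equivFin Γ s + 1
  have hc : c default = 0 := by simp [c]
  let b := Fintype.card Γ + 1
  have hb : ∀ s, c s < b := by
    intro s
    have := (Fintype.equivFin Γ s).2
    simp only [c, b]; split <;> omega
  have hinj : Function.Injective c := by
    intro s t h
    simp only [c] at h
    split at h <;> split at h
    · simp [*]
    · omega
    · omega
    · exact (Fintype.equivFin Γ).injective (Fin.ext (by omega))
  let v : ℕ → ℕ := fun n => Nat.ofDigits b ((u n).map c)
  have hv : Primrec v := by
    have h : Primrec fun n => ((u n).map c).foldr (fun s r => s + b * r) 0 :=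
      Primrec.list_foldr (hu c) (Primrec.const 0)
        (h := fun _ p => p.1 + b * p.2)
        (Primrec.nat_add.comp (Primrec.fst.comp Primrec.snd)
          (Primrec.nat_mul.comp (Primrec.const b) (Primrec.snd.comp Primrec.snd)))
    exact h.of_eq fun n => by simp [v, Nat.ofDigits_eq_foldr]
  have hinit : ∀ n, tapeValues c hc b (TM0.init (s₀ :: u n) : TM0.Cfg Γ Λ).Tape
      = fun x => if x then v n else 0 := by
    intro n
    funext x
    cases x
    · simp [tapeValues, TM0.init, Tape.mk₁, Tape.mk₂, Tape.mk', ListBlank.value_mk]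
    · simp [tapeValues, TM0.init, Tape.mk₁, Tape.mk₂, Tape.mk', ListBlank.value_mk, v]
  have hhead : ∀ n, (TM0.init (s₀ :: u n) : TM0.Cfg Γ Λ).Tape.head = s₀ := fun n => by
    simp [TM0.init, Tape.mk₁, Tape.mk₂, Tape.mk']
  refine ⟨_, _, inferInstance, fun n => tmRules M c b s₀ (v n),
    fun n => (TM0.eval M (s₀ :: u n)).Dom, fun n => ⟨rfl, rfl, rfl, rfl, rfl⟩, ?_, ?_, ?_, hund⟩
  · rintro (_ | ⟨q, s, s'⟩) (_ | _)
    · exact ⟨Computable.const _, Computable.const _⟩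
    · exact ⟨(primrec_natCast_int.comp hv).to_comp, (primrec_neg_natCast_int.comp hv).to_comp⟩
    all_goals exact ⟨Computable.const ((tmRules M c b s₀ 0).add (some (q, s, s')) _),
      Computable.const (-(tmRules M c b s₀ 0).add (some (q, s, s')) _)⟩
  · intro n hn
    obtain ⟨d, hd⟩ := Part.dom_iff_mem.1 (show (StateTransition.eval (TM0.step M) _).Dom from hn)
    obtain ⟨h1, h2⟩ := StateTransition.mem_eval.1 hd
    -- Here `X` comes from the halted tape. As `restart` ignores the pair it is applied to, the
    -- chain may begin with the same `X` with which it ends.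
    refine ⟨_, tmRules_transGen_of_reaches (hc := hc) h1 h2 none _ ?_ ?_⟩
    · rw [hhead]; rfl
    · intro x
      rw [hinit]
      cases x <;> simp [tmRules]
  · intro n X Y h
    exact halts_of_tmRules_transGen hb hinj rfl (hhead n) (hinit n) h

/-! ### Values of a run and the terminations of its counters -/

namespace MonitorAutomaton

variable {Letter State : Type} {n : ℕ}

theorem exists_last_none {f : ℕ → Option ℤ} {t₀ t : ℕ} (h₀ : f t₀ = none) (hle : t₀ ≤ t)
    (h : f t ≠ none) :
    ∃ m, t₀ ≤ m ∧ m < t ∧ f m = none ∧ ∀ i, m < i → i ≤ t → f i ≠ none := by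
  induction t, hle using Nat.le_induction with
  | base => exact absurd h₀ h
  | succ t hle ih =>
    by_cases ht : f t = none
    · refine ⟨t, hle, Nat.lt_succ_self t, ht, fun i h1 h2 => ?_⟩
      rwa [show i = t + 1 by omega]
    · obtain ⟨m, h1, h2, h3, h4⟩ := ih ht
      refine ⟨m, h1, by omega, h3, fun i hi1 hi2 => ?_⟩
      rcases Nat.lt_or_eq_of_le hi2 with hi | rfl
      · exact h4 i hi1 (by omega)
      · exact h

theorem IsRun.activated_unique {A : MonitorAutomaton Letter State n} {w : ℕ → Letter}
    {π : ℕ → Config State n} (h : A.IsRun w π) {i : ℕ} {j j' : Fin n} (hj : Activated π i j)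
    (hj' : Activated π i j') : j = j' := by
  obtain ⟨v, hv, hstep⟩ := h.2 i
  have key : ∀ j, Activated π i j → v j = CounterOp.start := by
    intro j hj
    have := hstep j
    rcases hvj : v j with _ | _ | z
    · rfl
    · rw [hvj] at this
      exact absurd this.2 hj.2
    · rw [hvj] at this
      simp only [CounterStep, hj.1, Option.map_none] at this
      exact absurd this hj.2
  exact A.start_unique _ _ _ _ hv _ _ (key j hj) (key j' hj')

theorem IsRun.hasValueAt_unique {A : MonitorAutomaton Letter State n} {w : ℕ → Letter}
    {π : ℕ → Config State n} (h : A.IsRun w π) {i : ℕ} {x x' : ℤ} (hx : HasValueAt π i x)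
    (hx' : HasValueAt π i x') : x = x' := by
  obtain ⟨j, k, h1, h2, h3, h4, h5⟩ := hx
  obtain ⟨j', k', h1', h2', h3', h4', h5'⟩ := hx'
  obtain rfl := h.activated_unique h1 h1'
  rcases lt_trichotomy k k' with hk | rfl | hk
  · exact absurd h5 (h3' (k + 1) (by omega) (by omega))
  · exact Option.some.inj (h4.symm.trans h4')
  · exact absurd h5' (h3 (k' + 1) (by omega) (by omega))

theorem IsRun.weights_eq {A : MonitorAutomaton Letter State n} {w : ℕ → Letter}
    {π : ℕ → Config State n} (h : A.IsRun w π) {i : ℕ} {x : ℤ} (hx : HasValueAt π i x) :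
    weights π i = some x := by
  have h' : ∃ x, HasValueAt π i x := ⟨x, hx⟩
  rw [weights, dif_pos h', h.hasValueAt_unique h'.choose_spec hx]

theorem hasValueAt_of_terminated {π : ℕ → Config State n} {j : Fin n} {t₀ k : ℕ} {x : ℤ}
    (h₀ : (π t₀).2 j = none) (hle : t₀ ≤ k) (hx : (π k).2 j = some x)
    (hk : (π (k + 1)).2 j = none) : ∃ m, t₀ ≤ m ∧ HasValueAt π m x := by
  obtain ⟨m, h1, h2, h3, h4⟩ := exists_last_none (f := fun t => (π t).2 j) h₀ hle (by simp [hx])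
  exact ⟨m, h1, j, k, ⟨h3, h4 _ (by omega) (by omega)⟩, h2, h4, hx, hk⟩

/-- A counter that is active at `T` has stayed active since its last activation, so the termination
that acceptance guarantees for this activation comes no earlier than `T`. -/
theorem IsAccepting.exists_none {A : MonitorAutomaton Letter State n} {w : ℕ → Letter}
    {π : ℕ → Config State n} (h : A.IsAccepting w π) (T : ℕ) (j : Fin n) :
    ∃ t, T ≤ t ∧ (π t).2 j = none := by
  by_cases hT : (π T).2 j = none
  · exact ⟨T, le_rfl, hT⟩
  obtain ⟨m, -, h2, h3, h4⟩ := exists_last_none (f := fun t => (π t).2 j) (h.1.1.2 j)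
    (Nat.zero_le T) hT
  obtain ⟨k, hk, -, hk'⟩ := h.2.2.2 m j ⟨h3, h4 _ (by omega) (by omega)⟩
  refine ⟨k + 1, ?_, hk'⟩
  by_contra hlt
  exact h4 (k + 1) (by omega) (by omega) hk'

theorem IsAccepting.infinite_weights {A : MonitorAutomaton Letter State n} {w : ℕ → Letter}
    {π : ℕ → Config State n} (h : A.IsAccepting w π) :
    {i | (weights π i).isSome = true}.Infinite := by
  refine Nat.frequently_atTop_iff_infinite.1 (h.2.2.1.mono ?_)
  rintro i ⟨j, hj⟩
  have hex := h.2.2.2 i j hj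
  classical
  obtain ⟨h1, h2, h3⟩ := Nat.find_spec hex
  obtain ⟨x, hx⟩ := Option.ne_none_iff_exists'.1 h2
  have hval : HasValueAt π i x := by
    refine ⟨j, Nat.find hex, hj, h1, fun m hm1 hm2 => ?_, hx, h3⟩
    induction m, hm1 using Nat.le_induction with
    | base => exact hj.2
    | succ m hm ih =>
      intro hn
      exact Nat.find_min hex (m := m) (by omega) ⟨hm, ih (by omega), hn⟩
  simp [h.1.weights_eq hval]

/-- Values are ordered by activation, whereas the argument about the automaton sees terminations.
The transfer works because every counter is idle at arbitrarily late times. -/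
theorem IsAccepting.eventually_terminated {A : MonitorAutomaton Letter State n} {w : ℕ → Letter}
    {π : ℕ → Config State n} (h : A.IsAccepting w π) {Q : ℤ → Prop}
    (hQ : ∀ᶠ k in atTop, Q (removeSilent (weights π) k)) :
    ∀ᶠ k in atTop, ∀ j x, (π k).2 j = some x → (π (k + 1)).2 j = none → Q x := by
  obtain ⟨K, hK⟩ := eventually_atTop.1 hQ
  -- From `t j` on, counter `j` only terminates activations made after the `K`-th value, so their
  -- values have index at least `K`.
  choose t ht ht' using h.exists_none (Nat.nth (fun i => (weights π i).isSome = true) K)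
  refine eventually_all.2 fun j => ?_
  filter_upwards [eventually_ge_atTop (t j)] with k hk x hx hx'
  obtain ⟨m, hm, hval⟩ := hasValueAt_of_terminated (ht' j) hk hx hx'
  have hw := h.1.weights_eq hval
  have hcount : K ≤ Nat.count (fun i => (weights π i).isSome = true) m := by
    rw [← Nat.count_nth_of_infinite h.infinite_weights K]
    exact Nat.count_monotone _ ((ht j).trans hm)
  have := hK _ hcount
  rw [removeSilent, Nat.nth_count (by simp [hw]), hw] at this
  exact this

theorem removeSilent_weights_eq_zero {π : ℕ → Config State n}
    (h : ∀ k j x, (π k).2 j = some x → (π (k + 1)).2 j = none → x = 0) :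
    removeSilent (weights π) = fun _ => 0 := by
  funext k
  rw [removeSilent, weights]
  -- A silent entry would be read as the default 0 of `removeSilent`, which is the required value
  -- anyway.
  split_ifs with hx
  · obtain ⟨j, k', -, -, -, h1, h2⟩ := hx.choose_spec
    simpa using h _ _ _ h1 h2
  · rfl

end MonitorAutomaton

/-! ### The block automaton and the invariant of its counters -/

/-- The effect of an instruction as a function. -/
def CounterOp.apply : CounterOp → Option ℤ → Option ℤ
  | .start, _ => some 0
  | .terminate, _ => none
  | .add z, u => u.map (fun x => x + z)

/-- The eight counters: the first four and the last four are used alternately. -/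
def counterClass (j : Fin 8) : Bool := decide (4 ≤ j.val)

/-- The coordinate that a counter is about. -/
def counterCoord (j : Fin 8) : Bool := decide (2 ≤ j.val % 4)

def counterSign (j : Fin 8) : ℤ := if j.val % 2 = 0 then 1 else -1

theorem exists_counter (p x : Bool) (ε : ℤ) (hε : ε = 1 ∨ ε = -1) :
    ∃ j, counterClass j = p ∧ counterCoord j = x ∧ counterSign j = ε := by
  rcases hε with rfl | rfl <;> revert p x <;> decide

namespace RuleSystem

variable {C R : Type} (P : RuleSystem C R)

/-- A letter: a rule, a tick (`none`), or a unit of one of the coordinates. -/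
abbrev Letter (R : Type) : Type := Option (R ⊕ Bool)

/-- A state: dead (`none`), or the rule of the previous block, the rule of the current block, the
parity of the current block, and the number of ticks in it. -/
abbrev BlockState (R : Type) : Type := Option (Option R × R × Bool × Fin 6)

open Classical in
/-- The transition function of an automaton that reads an infinite sequence of blocks. A block is
a rule followed by five ticks and a pair of natural numbers in unary. In each block, four counters
are started, and they are terminated at the end of the next block, with the values `±0` if and only
if the rule leads from the pair of the first to the pair of the second block. -/
noncomputable def delta : BlockState R → Letter R → BlockState R × (Fin 8 → CounterOp)
  | none, _ => (none, fun _ => .add 0)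
  | some (pr, r, p, k), some (.inl r') =>
    if k.val = 5 ∧ P.tgt r = P.src r' then
      (some (some r, r', !p, 0),
        fun j => if counterClass j ≠ p ∧ pr.isSome then .terminate else .add 0)
    else (none, fun _ => .add 0)
  | some (pr, r, p, k), none =>
    if h : k.val < 5 then
      (some (pr, r, p, ⟨k.val + 1, by omega⟩), fun j =>
        if counterClass j = p then
          -- A transition starts at most one counter, so four ticks start the four counters of the
          -- class; the fifth adds the constant of the rule to each of them.
          if j.val % 4 = k.val then .start
          else if k.val = 4 then .add (counterSign j * P.add r (counterCoord j)) else .add 0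
        else .add 0)
    else (none, fun _ => .add 0)
  | some (pr, r, p, k), some (.inr x) =>
    if k.val = 5 then
      (some (pr, r, p, k), fun j =>
        if counterCoord j = x then
          if counterClass j = p then .add (counterSign j * P.mul r x)
          -- The other class belongs to the previous block, for whose rule the pair now being read
          -- is the result `Y`.
          else match pr with
            | none => .add 0
            | some r₀ => .add (-(counterSign j * P.den r₀ x))
        else .add 0)
    else (none, fun _ => .add 0)

def initState : BlockState R := some (none, P.restart, false, 0)

theorem delta_start_unique (s : BlockState R) (a : Letter R) (i j : Fin 8)
    (hi : (P.delta s a).2 i = .start) (hj : (P.delta s a).2 j = .start) : i = j := by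
  rcases s with _ | ⟨pr, r, p, k⟩
  · simp [delta] at hi
  rcases a with _ | r' | x
  · by_cases hk : k.val < 5
    · have key : ∀ i, (P.delta (some (pr, r, p, k)) none).2 i = .start →
          counterClass i = p ∧ i.val % 4 = k.val := by
        intro i hi
        simp only [delta, dif_pos hk] at hi
        split_ifs at hi with h1 h2
        exact ⟨h1, h2⟩
      obtain ⟨h1, h2⟩ := key i hi
      obtain ⟨h3, h4⟩ := key j hj
      have h5 : (4 ≤ i.val ↔ 4 ≤ j.val) := by
        simpa [counterClass] using h1.trans h3.symm
      apply Fin.ext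
      omega
    · simp [delta, hk] at hi
  · simp only [delta] at hi
    split_ifs at hi
    simp only at hi
    split_ifs at hi
  · simp only [delta] at hi
    split at hi
    · simp only at hi
      split_ifs at hi
      split at hi <;> simp at hi
    · simp at hi

/-- The state and the values of the counters after `t` letters of the word `a`. -/
noncomputable def cfg (a : ℕ → Letter R) : ℕ → MonitorAutomaton.Config (BlockState R) 8
  | 0 => (P.initState, fun _ => none)
  | t + 1 => ((P.delta (cfg a t).1 (a t)).1,
      fun j => ((P.delta (cfg a t).1 (a t)).2 j).apply ((cfg a t).2 j))

/-- The pair that has been read so far in the current block. -/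
def current (a : ℕ → Letter R) : ℕ → Bool → ℕ
  | 0 => fun _ => 0
  | t + 1 => match a t with
    | none => current a t
    | some (.inl _) => fun _ => 0
    | some (.inr x) => fun y => current a t y + if y = x then 1 else 0

/-- The pair of the previous block. -/
def previous (a : ℕ → Letter R) : ℕ → Bool → ℕ
  | 0 => fun _ => 0
  | t + 1 => match a t with
    | some (.inl _) => current a t
    | _ => previous a t

/-- Here `z` is the part of the current pair read so far, and `y` is the pair of the previous block.
No unit is read before the fifth tick (`current_zero`), so a counter that starts at 0 has the value
that `started` prescribes. -/
structure Invariant (z y : Bool → ℕ) (u : Fin 8 → Option ℤ) (pr : Option R) (r : R) (p : Bool)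
    (k : Fin 6) : Prop where
  current_zero : k.val < 5 → z = fun _ => 0
  started : ∀ j, counterClass j = p → j.val % 4 < k.val → u j = some (counterSign j *
    (P.mul r (counterCoord j) * z (counterCoord j)
      + if k.val = 5 then P.add r (counterCoord j) else 0))
  not_started : ∀ j, counterClass j = p → k.val ≤ j.val % 4 → u j = none
  previous_none : pr = none → ∀ j, counterClass j ≠ p → u j = none
  previous_some : ∀ r₀, pr = some r₀ → P.tgt r₀ = P.src r ∧ ∀ j, counterClass j ≠ p →
    u j = some (counterSign j * (P.mul r₀ (counterCoord j) * y (counterCoord j)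
      + P.add r₀ (counterCoord j) - P.den r₀ (counterCoord j) * z (counterCoord j)))

theorem invariant (a : ℕ → Letter R) (t : ℕ) : ∀ pr r p k, (P.cfg a t).1 = some (pr, r, p, k) →
    P.Invariant (current a t) (previous a t) (P.cfg a t).2 pr r p k := by
  induction t with
  | zero =>
    intro pr r p k h
    simp only [cfg, initState, Option.some.injEq, Prod.mk.injEq] at h
    obtain ⟨rfl, rfl, rfl, rfl⟩ := h
    constructor <;> simp [current, cfg]
  | succ t ih =>
    intro pr r p k h
    rcases hs : (P.cfg a t).1 with _ | ⟨pr₀, r₀, p₀, k₀⟩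
    · simp [cfg, hs, delta] at h
    obtain ⟨i1, i2, i3, i4, i5⟩ := ih _ _ _ _ hs
    rcases ha : a t with _ | r' | x
    · by_cases hk : k₀.val < 5
      · simp only [cfg, hs, ha, delta, dif_pos hk, Option.some.injEq, Prod.mk.injEq] at h
        obtain ⟨rfl, rfl, rfl, rfl⟩ := h
        have hz := i1 hk
        simp only [current, previous, cfg, hs, ha, delta, dif_pos hk]
        refine ⟨fun _ => hz, fun j hj hjk => ?_, fun j hj hjk => ?_, fun hpr j hj => ?_,
          fun r₁ hr₁ => ⟨(i5 r₁ hr₁).1, fun j hj => ?_⟩⟩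
        · simp only at hjk
          simp only [hj, if_true, hz]
          by_cases h1 : j.val % 4 = k₀.val
          · have : ¬ (k₀.val + 1 = 5) := by omega
            simp [h1, this, CounterOp.apply]
          · have h2 := i2 j hj (by omega)
            have h3 : ¬ (k₀.val = 5) := by omega
            rw [if_neg h1, h2, hz]
            by_cases h4 : k₀.val = 4 <;> simp [h4, CounterOp.apply, h3]
        · simp only at hjk
          have h1 : ¬ (j.val % 4 = k₀.val) := by omega
          have h2 := i3 j hj (by omega)
          have h4 : ¬ (k₀.val = 4) := by omega
          simp [h1, h2, h4, CounterOp.apply, hj]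
        · simp [hj, i4 hpr j hj, CounterOp.apply]
        · simp [hj, (i5 r₁ hr₁).2 j hj, CounterOp.apply]
      · simp [cfg, hs, ha, delta, hk] at h
    · by_cases hk : k₀.val = 5 ∧ P.tgt r₀ = P.src r'
      · simp only [cfg, hs, ha, delta, if_pos hk, Option.some.injEq, Prod.mk.injEq] at h
        obtain ⟨rfl, rfl, rfl, rfl⟩ := h
        simp only [current, previous, cfg, hs, ha, delta, if_pos hk]
        refine ⟨fun _ => rfl, fun j hj hjk => by simp at hjk, fun j hj hjk => ?_, fun hpr => by
          simp at hpr, fun r₁ hr₁ => ?_⟩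
        · have hj' : counterClass j ≠ p₀ := by simp [hj]
          rcases pr₀ with _ | r₁
          · simp [i4 rfl j hj', CounterOp.apply]
          · simp [hj', CounterOp.apply]
        · obtain rfl := Option.some.inj hr₁
          refine ⟨hk.2, fun j hj => ?_⟩
          have hj' : counterClass j = p₀ := by
            revert hj; cases counterClass j <;> cases p₀ <;> simp
          have := i2 j hj' (by omega)
          simp [hj', this, hk.1, CounterOp.apply]
      · simp [cfg, hs, ha, delta, hk] at h
    · by_cases hk : k₀.val = 5
      · simp only [cfg, hs, ha, delta, if_pos hk, Option.some.injEq, Prod.mk.injEq] at h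
        obtain ⟨rfl, rfl, rfl, rfl⟩ := h
        simp only [current, previous, cfg, hs, ha, delta, if_pos hk]
        refine ⟨fun h => by omega, fun j hj hjk => ?_, fun j hj hjk => by omega, fun hpr j hj => ?_,
          fun r₁ hr₁ => ⟨(i5 r₁ hr₁).1, fun j hj => ?_⟩⟩
        · rw [i2 j hj hjk]
          by_cases hx : counterCoord j = x
          · subst hx
            simp [hj, CounterOp.apply]
            ring
          · simp [hx, CounterOp.apply]
        · subst hpr
          rw [i4 rfl j hj]
          by_cases hx : counterCoord j = x <;> simp [hx, hj, CounterOp.apply]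
        · subst hr₁
          rw [(i5 r₁ rfl).2 j hj]
          by_cases hx : counterCoord j = x
          · subst hx
            simp [hj, CounterOp.apply]
            ring
          · simp [hx, CounterOp.apply]
      · simp [cfg, hs, ha, delta, hk] at h

/-- `CounterOp.apply` ignores the side conditions on `start` and `terminate`. By the invariant they
always hold, so the automaton never blocks. -/
theorem counterStep_apply (a : ℕ → Letter R) (t : ℕ) (j : Fin 8) :
    MonitorAutomaton.CounterStep ((P.delta (P.cfg a t).1 (a t)).2 j) ((P.cfg a t).2 j)
      ((P.cfg a (t + 1)).2 j) := by
  have happ : (P.cfg a (t + 1)).2 j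
    = ((P.delta (P.cfg a t).1 (a t)).2 j).apply ((P.cfg a t).2 j) := rfl
  rw [happ]
  rcases hop : (P.delta (P.cfg a t).1 (a t)).2 j with _ | _ | z
  · refine ⟨?_, rfl⟩
    rcases hs : (P.cfg a t).1 with _ | ⟨pr, r, p, k⟩
    · simp [hs, delta] at hop
    have inv := P.invariant a t _ _ _ _ hs
    rw [hs] at hop
    rcases ha : a t with _ | r' | x
    · by_cases hk : k.val < 5
      · simp only [ha, delta, dif_pos hk] at hop
        split_ifs at hop with h1 h2
        exact inv.not_started j h1 h2.ge
      · simp [ha, delta, hk] at hop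
    · by_cases hk : k.val = 5 ∧ P.tgt r = P.src r'
      · simp only [ha, delta, if_pos hk] at hop
        split_ifs at hop
      · simp [ha, delta, hk] at hop
    · by_cases hk : k.val = 5
      · simp only [ha, delta, if_pos hk] at hop
        split_ifs at hop
        split at hop <;> simp at hop
      · simp [ha, delta, hk] at hop
  · refine ⟨?_, rfl⟩
    rcases hs : (P.cfg a t).1 with _ | ⟨pr, r, p, k⟩
    · simp [hs, delta] at hop
    have inv := P.invariant a t _ _ _ _ hs
    rw [hs] at hop
    rcases ha : a t with _ | r' | x
    · by_cases hk : k.val < 5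
      · simp only [ha, delta, dif_pos hk] at hop
        split_ifs at hop
      · simp [ha, delta, hk] at hop
    · by_cases hk : k.val = 5 ∧ P.tgt r = P.src r'
      · simp only [ha, delta, if_pos hk] at hop
        split_ifs at hop with h
        obtain ⟨r₀, hr₀⟩ := Option.isSome_iff_exists.1 h.2
        rw [(inv.previous_some r₀ hr₀).2 j h.1]
        simp
      · simp [ha, delta, hk] at hop
    · by_cases hk : k.val = 5
      · simp only [ha, delta, if_pos hk] at hop
        split_ifs at hop
        split at hop <;> simp at hop
      · simp [ha, delta, hk] at hop
  · rfl

/-- The terminated value is, up to sign, the defect in the equation of the previous rule between the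
previous pair and the current one. -/
theorem terminated_iff (a : ℕ → Letter R) {t : ℕ} {j : Fin 8} {x : ℤ} :
    ((P.cfg a t).2 j = some x ∧ (P.cfg a (t + 1)).2 j = none) ↔
      ∃ r₀ r p k r', (P.cfg a t).1 = some (some r₀, r, p, k) ∧ k.val = 5 ∧ a t = some (.inl r') ∧
        P.tgt r = P.src r' ∧ counterClass j ≠ p ∧
        x = counterSign j * (P.mul r₀ (counterCoord j) * previous a t (counterCoord j)
          + P.add r₀ (counterCoord j) - P.den r₀ (counterCoord j) * current a t (counterCoord j)) := by
  constructor
  · rintro ⟨h1, h2⟩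
    have h3 : (P.delta (P.cfg a t).1 (a t)).2 j = .terminate := by
      change CounterOp.apply _ _ = none at h2
      rcases hop : (P.delta (P.cfg a t).1 (a t)).2 j with _ | _ | z
      · simp [hop, CounterOp.apply] at h2
      · rfl
      · simp [hop, CounterOp.apply, h1] at h2
    rcases hs : (P.cfg a t).1 with _ | ⟨pr, r, p, k⟩
    · simp [hs, delta] at h3
    have inv := P.invariant a t _ _ _ _ hs
    rw [hs] at h3
    rcases ha : a t with _ | r' | y
    · by_cases hk : k.val < 5
      · simp only [ha, delta, dif_pos hk] at h3
        split_ifs at h3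
      · simp [ha, delta, hk] at h3
    · by_cases hk : k.val = 5 ∧ P.tgt r = P.src r'
      · simp only [ha, delta, if_pos hk] at h3
        split_ifs at h3 with h
        obtain ⟨r₀, rfl⟩ := Option.isSome_iff_exists.1 h.2
        have := (inv.previous_some r₀ rfl).2 j h.1
        exact ⟨r₀, r, p, k, r', rfl, hk.1, rfl, hk.2, h.1, Option.some.inj (h1.symm.trans this)⟩
      · simp [ha, delta, hk] at h3
    · by_cases hk : k.val = 5
      · simp only [ha, delta, if_pos hk] at h3
        split_ifs at h3
        split at h3 <;> simp at h3
      · simp [ha, delta, hk] at h3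
  · rintro ⟨r₀, r, p, k, r', hs, hk, ha, hr, hj, rfl⟩
    have inv := P.invariant a t _ _ _ _ hs
    refine ⟨(inv.previous_some r₀ rfl).2 j hj, ?_⟩
    simp [cfg, hs, ha, delta, hk, hr, hj, CounterOp.apply]

end RuleSystem

/-! ### From accepting runs to computations -/

namespace RuleSystem

variable {C R : Type} (P : RuleSystem C R)

/-- A configuration at the beginning of a block that follows a block with the rule `restart`. -/
def IsRestarted (s : BlockState R) : Prop := ∃ r p, s = some (some P.restart, r, p, 0)

theorem cfg_ne_none (a : ℕ → Letter R) (h : ∃ᶠ t in atTop, P.IsRestarted (P.cfg a t).1) (t : ℕ) :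
    (P.cfg a t).1 ≠ none := by
  intro ht
  have key : ∀ t', t ≤ t' → (P.cfg a t').1 = none := by
    intro t' ht'
    induction t', ht' using Nat.le_induction with
    | base => exact ht
    | succ t' _ ih => simp [cfg, ih, delta]
  obtain ⟨t', ht', r, p, hr⟩ := frequently_atTop.1 h t
  simp [key t' ht'] at hr

theorem eq_zero_of_sign {Q : ℤ → Prop} (hQ : (∀ x, Q x → x ≤ 0) ∨ ∀ x, Q x → 0 ≤ x) {e : ℤ}
    (h₁ : Q (1 * e)) (h₂ : Q (-1 * e)) : e = 0 := by
  rcases hQ with hQ | hQ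
  · have := hQ _ h₁; have := hQ _ h₂; omega
  · have := hQ _ h₁; have := hQ _ h₂; omega

/-- After the time from which all terminated values satisfy `Q`, every completed step is correct.
Following the steps from one late use of `restart` to the next gives the chain. -/
theorem exists_transGen_of_cfg (a : ℕ → Letter R)
    (h : ∃ᶠ t in atTop, P.IsRestarted (P.cfg a t).1)
    {Q : ℤ → Prop} (hQ : (∀ x, Q x → x ≤ 0) ∨ ∀ x, Q x → 0 ≤ x)
    (hgood : ∀ᶠ t in atTop, ∀ j x, (P.cfg a t).2 j = some x → (P.cfg a (t + 1)).2 j = none → Q x) :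
    ∃ X Y, Relation.TransGen P.Next (P.restart, X) (P.restart, Y) := by
  by_contra hno
  push Not at hno
  obtain ⟨T, hT⟩ := eventually_atTop.1 hgood
  obtain ⟨t₀, ht₀, r₁, p₁, h₁⟩ := frequently_atTop.1 h T
  have hne := P.cfg_ne_none a h
  have hrule : ∀ t, t₀ ≤ t → ∀ r₀ r p k X r', (P.cfg a t).1 = some (some r₀, r, p, k) →
      Relation.ReflTransGen P.Next (P.restart, X) (r₀, previous a t) → a t = some (.inl r') →
      (P.cfg a (t + 1)).1 = some (some r, r', !p, 0) ∧ r ≠ P.restart ∧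
        Relation.ReflTransGen P.Next (P.restart, X) (r, previous a (t + 1)) := by
    intro t ht r₀ r p k X r' hs hX ha
    have hk : k.val = 5 ∧ P.tgt r = P.src r' := by
      by_contra hk
      refine hne (t + 1) ?_
      simp [cfg, hs, ha, delta, hk]
    have inv := P.invariant a t _ _ _ _ hs
    have hstep : P.Step r₀ (previous a t) (current a t) := by
      intro x
      have key : ∀ ε : ℤ, (ε = 1 ∨ ε = -1) → Q (ε * (P.mul r₀ x * previous a t x + P.add r₀ x
          - P.den r₀ x * current a t x)) := by
        intro ε hε
        -- Both signs of the defect occur among the counters of the class that is terminated now.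
        obtain ⟨j, h1, rfl, rfl⟩ := exists_counter (!p) x ε hε
        have hj : counterClass j ≠ p := by simp [h1]
        obtain ⟨h2, h3⟩ := (P.terminated_iff a (t := t) (j := j)).2
          ⟨r₀, r, p, k, r', hs, hk.1, ha, hk.2, hj, rfl⟩
        exact hT t (ht₀.trans ht) j _ h2 h3
      have := eq_zero_of_sign hQ (key 1 (.inl rfl)) (key (-1) (.inr rfl))
      linarith
    have hnext : P.Next (r₀, previous a t) (r, current a t) :=
      ⟨(inv.previous_some r₀ rfl).1, hstep⟩
    have htrans := Relation.TransGen.tail' hX hnext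
    refine ⟨by simp [cfg, hs, ha, delta, hk], ?_, ?_⟩
    · rintro rfl
      exact hno _ _ htrans
    · simpa [previous, ha] using htrans.to_reflTransGen
  have hJ : ∀ t, t₀ ≤ t → ∃ r₀ r p k X, (P.cfg a t).1 = some (some r₀, r, p, k) ∧
      Relation.ReflTransGen P.Next (P.restart, X) (r₀, previous a t) := by
    intro t ht
    induction t, ht using Nat.le_induction with
    | base => exact ⟨_, _, _, _, _, h₁, .refl⟩
    | succ t ht ih =>
      obtain ⟨r₀, r, p, k, X, hs, hX⟩ := ih
      rcases ha : a t with _ | r' | x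
      · have hk : k.val < 5 := by
          by_contra hk
          exact hne (t + 1) (by simp [cfg, hs, ha, delta, hk])
        exact ⟨r₀, r, p, _, X, by simp [cfg, hs, ha, delta, hk]; rfl, by simpa [previous, ha]⟩
      · obtain ⟨h2, -, h3⟩ := hrule t ht _ _ _ _ _ _ hs hX ha
        exact ⟨_, _, _, _, _, h2, h3⟩
      · have hk : k.val = 5 := by
          by_contra hk
          exact hne (t + 1) (by simp [cfg, hs, ha, delta, hk])
        exact ⟨r₀, r, p, k, X, by simp [cfg, hs, ha, delta, hk], by simpa [previous, ha]⟩
  -- A state with 0 ticks can only be entered by reading a rule, so at `t₂` a block with the rule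
  -- `restart` has just ended, against `hrule`.
  obtain ⟨t₂, ht₂, r₂, p₂, h₂⟩ := frequently_atTop.1 h (t₀ + 1)
  obtain ⟨t, rfl⟩ : ∃ t, t₂ = t + 1 := ⟨t₂ - 1, by omega⟩
  obtain ⟨r₀, r, p, k, X, hs, hX⟩ := hJ t (by omega)
  rcases ha : a t with _ | r' | x
  · by_cases hk : k.val < 5
    · simp only [cfg, hs, ha, delta, dif_pos hk, Option.some.injEq, Prod.mk.injEq] at h₂
      simpa using congrArg Fin.val h₂.2.2.2
    · simp [cfg, hs, ha, delta, hk] at h₂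
  · obtain ⟨h3, h4, -⟩ := hrule t (by omega) _ _ _ _ _ _ hs hX ha
    rw [h₂] at h3
    simp only [Option.some.injEq, Prod.mk.injEq] at h3
    exact h4 h3.1.symm
  · by_cases hk : k.val = 5
    · simp only [cfg, hs, ha, delta, if_pos hk, Option.some.injEq, Prod.mk.injEq] at h₂
      obtain ⟨-, -, -, rfl⟩ := h₂
      simp at hk
    · simp [cfg, hs, ha, delta, hk] at h₂

/-! ### The word of a correct infinite computation -/

/-- A position in the word that describes a sequence of rules and pairs: the block, the number of
ticks, and the pair that has been read in the block. -/
structure Position where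
  block : ℕ
  ticks : ℕ
  left : ℕ
  right : ℕ

namespace Position

variable (f : ℕ → R × (Bool → ℕ))

def step (g : Position) : Letter R × Position :=
  if g.ticks < 5 then (none, { g with ticks := g.ticks + 1 })
  else if g.left < (f g.block).2 false then (some (.inr false), { g with left := g.left + 1 })
  else if g.right < (f g.block).2 true then (some (.inr true), { g with right := g.right + 1 })
  else (some (.inl (f (g.block + 1)).1), ⟨g.block + 1, 0, 0, 0⟩)

def position : ℕ → Position
  | 0 => ⟨0, 0, 0, 0⟩
  | t + 1 => (step f (position t)).2

def word (t : ℕ) : Letter R := (step f (position f t)).1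

/-- Until the block is complete, each letter lowers the number of ticks and units that it still
lacks. -/
theorem exists_next_block (t : ℕ) : ∃ t', t ≤ t' ∧ (position f t').block = (position f t).block ∧
    ¬ (position f t').ticks < 5 ∧ ¬ (position f t').left < (f (position f t').block).2 false ∧
    ¬ (position f t').right < (f (position f t').block).2 true := by
  induction hm : (5 - (position f t).ticks) + ((f (position f t).block).2 false - (position f t).left)
      + ((f (position f t).block).2 true - (position f t).right) using Nat.strong_induction_on
    generalizing t with
  | _ m ih =>
    by_cases hdone : ¬ (position f t).ticks < 5 ∧ ¬ (position f t).left < (f (position f t).block).2 false ∧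
        ¬ (position f t).right < (f (position f t).block).2 true
    · exact ⟨t, le_rfl, rfl, hdone⟩
    · have hb : (position f (t + 1)).block = (position f t).block := by
        rw [position, step]; split_ifs <;> first | rfl | (exfalso; tauto)
      have hlt : (5 - (position f (t + 1)).ticks)
          + ((f (position f t).block).2 false - (position f (t + 1)).left)
          + ((f (position f t).block).2 true - (position f (t + 1)).right) < m := by
        rw [position, step]; split_ifs <;> simp only <;> omega
      obtain ⟨t', h1, h2, h3⟩ := ih _ hlt (t + 1) (by rw [hb])
      exact ⟨t', by omega, h2.trans hb, h3⟩

/-- The position at the end of the block `i`. -/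
theorem exists_end (i : ℕ) : ∃ t, i ≤ t ∧ (position f t).block = i ∧ ¬ (position f t).ticks < 5 ∧
    ¬ (position f t).left < (f i).2 false ∧ ¬ (position f t).right < (f i).2 true := by
  induction i with
  | zero =>
    obtain ⟨t, -, h2, h3⟩ := exists_next_block f 0
    have h0 : (position f t).block = 0 := h2
    rw [h0] at h3
    exact ⟨t, Nat.zero_le t, h0, h3⟩
  | succ i ih =>
    obtain ⟨t, h1, h2, h3, h4, h5⟩ := ih
    have h6 : position f (t + 1) = ⟨i + 1, 0, 0, 0⟩ := by
      rw [position, step, h2, if_neg h3, if_neg h4, if_neg h5]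
    obtain ⟨t', h7, h8, h9⟩ := exists_next_block f (t + 1)
    rw [h6] at h8
    rw [h8] at h9
    exact ⟨t', by omega, h8, h9⟩

end Position

variable {P}

section

open Position

variable {f : ℕ → R × (Bool → ℕ)} (hf : ∀ i, P.Next (f i) (f (i + 1))) (h₀ : (f 0).1 = P.restart)
include hf h₀

/-- The automaton follows the description: its state and the pairs it has seen are determined by the
position, and the parity of the block number selects the class of counters. -/
theorem cfg_word (t : ℕ) : (∃ h : (position f t).ticks < 6, (P.cfg (word f) t).1 =
      some (if (position f t).block = 0 then none else some (f ((position f t).block - 1)).1,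
        (f (position f t).block).1, decide ((position f t).block % 2 = 1), ⟨(position f t).ticks, h⟩)) ∧
    (current (word f) t = fun x => if x then (position f t).right else (position f t).left) ∧
    ((position f t).block ≠ 0 → previous (word f) t = (f ((position f t).block - 1)).2) ∧
    (position f t).left ≤ (f (position f t).block).2 false ∧ (position f t).right ≤ (f (position f t).block).2 true := by
  induction t with
  | zero =>
    refine ⟨⟨by simp [position], ?_⟩, ?_, ?_, ?_, ?_⟩ <;> simp [position, cfg, initState, h₀, current]
  | succ t ih =>
    obtain ⟨⟨hlt, h1⟩, h2, h3, h4, h5⟩ := ih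
    by_cases c1 : (position f t).ticks < 5
    · have ha : word f t = none := by simp [word, step, c1]
      have hg : position f (t + 1) = { position f t with ticks := (position f t).ticks + 1 } := by
        simp [position, step, c1]
      rw [hg]
      refine ⟨⟨by simp only; omega, ?_⟩, ?_, ?_, h4, h5⟩
      · simp [cfg, h1, ha, delta, c1]
      · simp [current, ha, h2]
      · simpa [previous, ha] using h3
    by_cases c2 : (position f t).left < (f (position f t).block).2 false
    · have ha : word f t = some (.inr false) := by simp [word, step, c1, c2]
      have hg : position f (t + 1) = { position f t with left := (position f t).left + 1 } := by
        simp [position, step, c1, c2]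
      have h5' : (position f t).ticks = 5 := by omega
      rw [hg]
      refine ⟨⟨by simp only; omega, ?_⟩, ?_, ?_, ?_, h5⟩
      · simp [cfg, h1, ha, delta, h5']
      · funext x
        cases x <;> simp [current, ha, h2]
      · simpa [previous, ha] using h3
      · simp only; omega
    by_cases c3 : (position f t).right < (f (position f t).block).2 true
    · have ha : word f t = some (.inr true) := by simp [word, step, c1, c2, c3]
      have hg : position f (t + 1) = { position f t with right := (position f t).right + 1 } := by
        simp [position, step, c1, c2, c3]
      have h5' : (position f t).ticks = 5 := by omega
      rw [hg]
      refine ⟨⟨by simp only; omega, ?_⟩, ?_, ?_, h4, ?_⟩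
      · simp [cfg, h1, ha, delta, h5']
      · funext x
        cases x <;> simp [current, ha, h2]
      · simpa [previous, ha] using h3
      · simp only; omega
    · have ha : word f t = some (.inl (f ((position f t).block + 1)).1) := by
        simp [word, step, c1, c2, c3]
      have hg : position f (t + 1) = ⟨(position f t).block + 1, 0, 0, 0⟩ := by
        simp [position, step, c1, c2, c3]
      have h5' : (position f t).ticks = 5 := by omega
      rw [hg]
      refine ⟨⟨by simp, ?_⟩, ?_, ?_, Nat.zero_le _, Nat.zero_le _⟩
      · have h6 := (hf (position f t).block).1
        have h7 : (!decide ((position f t).block % 2 = 1)) = decide (((position f t).block + 1) % 2 = 1) := by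
          rw [← decide_not]; congr 1; apply propext; omega
        simp [cfg, h1, ha, delta, h5', h6, ← h7]
      · funext x
        cases x <;> simp [current, ha]
      · intro _
        simp only [previous, ha, h2, Nat.add_sub_cancel]
        funext x
        cases x
        · simp only [Bool.false_eq_true, if_false]; omega
        · simp only [if_true]; omega

/-- A termination occurs at a rule letter, when both blocks involved are complete; the value is then
the defect of a correct step. -/
theorem terminated_word {t : ℕ} {j : Fin 8} {x : ℤ} (h1 : (P.cfg (word f) t).2 j = some x)
    (h2 : (P.cfg (word f) (t + 1)).2 j = none) : x = 0 := by
  obtain ⟨r₀, r, p, k, r', hs, hk, ha, -, -, rfl⟩ := (P.terminated_iff _).1 ⟨h1, h2⟩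
  obtain ⟨⟨hlt, h3⟩, h4, h5, h6, h7⟩ := cfg_word hf h₀ t
  rw [hs] at h3
  simp only [Option.some.injEq, Prod.mk.injEq] at h3
  obtain ⟨h8, -, -, rfl⟩ := h3
  have hb : (position f t).block ≠ 0 := by
    intro h; simp [h] at h8
  rw [if_neg hb] at h8
  obtain rfl := Option.some.inj h8
  have hend : ¬ (position f t).left < (f (position f t).block).2 false ∧
      ¬ (position f t).right < (f (position f t).block).2 true := by
    rw [word, step] at ha
    split_ifs at ha with c1 c2 c3
    · simp at ha
    · simp at ha
    · exact ⟨c2, c3⟩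
  have hcur : current (word f) t = (f (position f t).block).2 := by
    rw [h4]
    funext x
    cases x
    · simp only [Bool.false_eq_true, if_false]; omega
    · simp only [if_true]; omega
  have hn := (hf ((position f t).block - 1)).2 (counterCoord j)
  rw [Nat.sub_add_cancel (Nat.pos_of_ne_zero hb)] at hn
  rw [hcur, h5 hb, hn]
  ring

theorem frequently_isRestarted (hr : ∃ᶠ i in atTop, (f i).1 = P.restart) :
    ∃ᶠ t in atTop, P.IsRestarted (P.cfg (word f) t).1 := by
  refine frequently_atTop.2 fun N => ?_
  obtain ⟨i, hi, hri⟩ := frequently_atTop.1 hr N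
  obtain ⟨t, h1, h2, h3, h4, h5⟩ := exists_end f i
  have h6 : position f (t + 1) = ⟨i + 1, 0, 0, 0⟩ := by
    rw [position, step, h2, if_neg h3, if_neg h4, if_neg h5]
  obtain ⟨⟨hlt, h7⟩, -⟩ := cfg_word hf h₀ (t + 1)
  simp only [h6] at h7
  refine ⟨t + 1, by omega, (f (i + 1)).1, decide ((i + 1) % 2 = 1), h7.trans ?_⟩
  simp [hri]

theorem frequently_activated :
    ∃ᶠ t in atTop, ∃ j, (P.cfg (word f) t).2 j = none ∧ (P.cfg (word f) (t + 1)).2 j ≠ none := by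
  refine frequently_atTop.2 fun i => ?_
  obtain ⟨t, h1, h2, h3, h4, h5⟩ := exists_end f i
  have h6 : position f (t + 1) = ⟨i + 1, 0, 0, 0⟩ := by
    rw [position, step, h2, if_neg h3, if_neg h4, if_neg h5]
  obtain ⟨⟨hlt, h7⟩, -⟩ := cfg_word hf h₀ (t + 1)
  simp only [h6] at h7
  have ha : word f (t + 1) = none := by simp [word, step, h6]
  have inv := P.invariant _ _ _ _ _ _ h7
  obtain ⟨j, hj, hj'⟩ : ∃ j, counterClass j = decide ((i + 1) % 2 = 1) ∧ j.val % 4 = 0 := by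
    generalize decide ((i + 1) % 2 = 1) = p
    revert p; decide
  refine ⟨t + 1, by omega, j, inv.not_started j hj (by simp), ?_⟩
  rw [cfg]
  simp [h7, ha, delta, hj, hj', CounterOp.apply]

/-- Each block after the first ends by terminating the class of its predecessor, so each class is
terminated in one of any two consecutive later blocks. -/
theorem exists_terminated (t : ℕ) (j : Fin 8) :
    ∃ k, t < k ∧ (P.cfg (word f) k).2 j ≠ none ∧ (P.cfg (word f) (k + 1)).2 j = none := by
  obtain ⟨i, hi, hij⟩ : ∃ i, t + 1 ≤ i ∧ counterClass j ≠ decide (i % 2 = 1) := by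
    by_cases h : counterClass j ≠ decide ((t + 1) % 2 = 1)
    · exact ⟨t + 1, le_rfl, h⟩
    · refine ⟨t + 2, by omega, ?_⟩
      rw [not_not.1 h]
      intro h'
      rw [decide_eq_decide] at h'
      omega
  obtain ⟨k, h1, h2, h3, h4, h5⟩ := exists_end f i
  obtain ⟨⟨hlt, h7⟩, -⟩ := cfg_word hf h₀ k
  have hi0 : i ≠ 0 := by omega
  rw [h2, if_neg hi0] at h7
  have ha : word f k = some (.inl (f (i + 1)).1) := by
    rw [word, step, if_neg h3]
    simp only [h2]
    rw [if_neg h4, if_neg h5]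
  obtain ⟨h8, h9⟩ := (P.terminated_iff (word f) (t := k) (j := j)).2
    ⟨_, _, _, _, _, h7, by simp only; omega, ha, (hf i).1, hij, rfl⟩
  exact ⟨k, by omega, by simp [h8], h9⟩

end

theorem exists_periodic {α : Type} {r : α → α → Prop} {a : α} (h : Relation.TransGen r a a) :
    ∃ f : ℕ → α, f 0 = a ∧ (∀ i, r (f i) (f (i + 1))) ∧ ∃ᶠ i in atTop, f i = a := by
  have path : ∀ b, Relation.TransGen r a b →
      ∃ (m : ℕ) (g : ℕ → α), g 0 = a ∧ g (m + 1) = b ∧ ∀ i ≤ m, r (g i) (g (i + 1)) := by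
    intro b hb
    induction hb with
    | @single b hb => exact ⟨0, fun i => if i = 0 then a else b, by simp, by simp, by simpa⟩
    | @tail b c _ hc ih =>
      obtain ⟨m, g, h1, h2, h3⟩ := ih
      refine ⟨m + 1, fun i => if i ≤ m + 1 then g i else c, by simpa, by simp, fun i hi => ?_⟩
      rcases Nat.lt_or_eq_of_le hi with hi | rfl
      · simpa [hi.le, show i ≤ m by omega] using h3 i (by omega)
      · simpa [h2] using hc
  obtain ⟨m, g, h1, h2, h3⟩ := path a h
  refine ⟨fun i => g (i % (m + 1)), by simpa, fun i => ?_, frequently_atTop.2 fun N => ?_⟩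
  · have hlt : i % (m + 1) < m + 1 := Nat.mod_lt i (Nat.succ_pos m)
    have h4 := h3 (i % (m + 1)) (by omega)
    by_cases hi : i % (m + 1) = m
    · have h5 : (i + 1) % (m + 1) = 0 := by
        rw [Nat.add_mod, hi]
        rcases m with _ | m <;> simp
      rw [hi, h2] at h4
      simp only [hi, h5, h1]
      exact h4
    · have h5 : (i + 1) % (m + 1) = i % (m + 1) + 1 := by
        rw [Nat.add_mod, Nat.mod_eq_of_lt (a := i % (m + 1) + 1 % (m + 1))]
        · rcases m with _ | m
          · omega
          · rw [Nat.mod_eq_of_lt (a := 1) (by omega)]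
        · rcases m with _ | m
          · omega
          · rw [Nat.mod_eq_of_lt (a := 1) (by omega)]; omega
      simpa only [h5] using h4
  · exact ⟨N * (m + 1), Nat.le_mul_of_pos_right _ (Nat.succ_pos m), by simpa⟩

end RuleSystem

/-! ### Computable descriptions of the automata -/

theorem Computable.fin_pi {α σ : Type} [Primcodable α] [Primcodable σ] {n : ℕ}
    {f : α → Fin n → σ} (hf : ∀ i, Computable fun a => f a i) : Computable f := by
  have h : Primrec (Equiv.vectorEquivFin σ n) :=
    Primrec.of_equiv_symm (e := (Equiv.vectorEquivFin σ n).symm)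
  refine (h.to_comp.comp (Computable.vector_ofFn (f := fun i a => f a i) hf)).of_eq fun a => ?_
  funext i
  simp [Equiv.vectorEquivFin]

theorem Computable.list_map_const {α β σ : Type} [Primcodable α] [Primcodable σ]
    {f : α → β → σ} (hf : ∀ b, Computable fun a => f a b) (l : List β) :
    Computable fun a => l.map (f a) := by
  induction l with
  | nil => exact Computable.const []
  | cons b l ih => exact Computable.list_cons.comp (hf b) ih

theorem CounterOp.computable_add {α : Type} [Primcodable α] {z : α → ℤ} (hz : Computable z) :
    Computable fun a => CounterOp.add (z a) := by
  have h : Primrec CounterOp.equivSum.symm := Primrec.of_equiv_symm (e := CounterOp.equivSum)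
  exact h.to_comp.comp (Computable.sumInr.comp hz)

namespace RuleSystem

variable {C R : Type} [Fintype R] (P : RuleSystem C R)

noncomputable abbrev stateIndex (R : Type) [Fintype R] :
    BlockState R ≃ Fin (Fintype.card (BlockState R)) := Fintype.equivFin _

noncomputable abbrev letterIndex (R : Type) [Fintype R] :
    Letter R ≃ Fin (Fintype.card (Letter R)) := Fintype.equivFin _

open Classical in
/-- The description of the automaton with the transition function `delta`. -/
noncomputable def description : AutomatonDescription 8 where
  letters := Fintype.card (Letter R)
  states := Fintype.card (BlockState R)
  initial := [(stateIndex R P.initState).val]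
  trans := (Finset.univ : Finset (BlockState R × Letter R)).toList.map fun p =>
    ((stateIndex R p.1).val, (letterIndex R p.2).val, (stateIndex R (P.delta p.1 p.2).1).val,
      (P.delta p.1 p.2).2)
  accepting := (Finset.univ.filter fun s => P.IsRestarted s).toList.map
    fun s => (stateIndex R s).val

noncomputable abbrev automaton : MonitorAutomaton (Fin (Fintype.card (Letter R)))
    (Fin (Fintype.card (BlockState R))) 8 := P.description.toAutomaton

theorem mem_initial (q) : q ∈ P.automaton.initial ↔ q = stateIndex R P.initState := by
  simp [automaton, AutomatonDescription.toAutomaton, description, Fin.ext_iff]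

theorem mem_accepting (q) :
    q ∈ P.automaton.accepting ↔ P.IsRestarted ((stateIndex R).symm q) := by
  simp only [automaton, AutomatonDescription.toAutomaton, description, List.mem_map,
    Finset.mem_toList, Finset.mem_filter, Finset.mem_univ, true_and, Set.mem_ofPred_eq]
  constructor
  · rintro ⟨s, hs, h⟩
    obtain rfl : stateIndex R s = q := Fin.ext h
    simpa using hs
  · intro h
    exact ⟨_, h, by simp⟩

theorem mem_trans (q a q') (v) : (q, a, q', v) ∈ P.automaton.trans ↔
    q' = stateIndex R (P.delta ((stateIndex R).symm q) ((letterIndex R).symm a)).1 ∧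
      v = (P.delta ((stateIndex R).symm q) ((letterIndex R).symm a)).2 := by
  simp only [automaton, AutomatonDescription.toAutomaton, description, List.mem_map,
    Finset.mem_toList, Finset.mem_univ, true_and, Set.mem_ofPred_eq, Prod.exists, Prod.mk.injEq]
  constructor
  · rintro ⟨⟨s, b, h1, h2, h3, rfl⟩, -⟩
    obtain rfl : stateIndex R s = q := Fin.ext h1
    obtain rfl : letterIndex R b = a := Fin.ext h2
    exact ⟨Fin.ext (by simp [← h3]), by simp⟩
  · rintro ⟨rfl, rfl⟩
    exact ⟨⟨_, _, by simp, by simp, rfl, rfl⟩, fun i j hi hj => P.delta_start_unique _ _ i j hi hj⟩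

theorem automaton_isDeterministic : P.automaton.IsDeterministic := by
  refine ⟨⟨_, (P.mem_initial _).2 rfl, fun q hq => (P.mem_initial q).1 hq⟩, fun q a => ?_⟩
  refine ⟨(_, _), (P.mem_trans q a _ _).2 ⟨rfl, rfl⟩, fun p hp => ?_⟩
  obtain ⟨h1, h2⟩ := (P.mem_trans q a _ _).1 hp
  exact Prod.ext h1 h2

noncomputable def run (a : ℕ → Letter R) (t : ℕ) :
    MonitorAutomaton.Config (Fin (Fintype.card (BlockState R))) 8 :=
  (stateIndex R (P.cfg a t).1, (P.cfg a t).2)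

/-- Every word has exactly one run, so the infimum over accepting runs in the value of an accepted
word is over a single run. -/
theorem isRun_iff (w π) : P.automaton.IsRun w π ↔ π = P.run ((letterIndex R).symm ∘ w) := by
  constructor
  · rintro ⟨⟨h1, h2⟩, h3⟩
    funext t
    induction t with
    | zero => exact Prod.ext ((P.mem_initial _).1 h1) (funext h2)
    | succ t ih =>
      obtain ⟨v, hv, hstep⟩ := h3 t
      obtain ⟨h4, rfl⟩ := (P.mem_trans _ _ _ _).1 hv
      rw [ih] at h4 hstep
      simp only [run, Equiv.symm_apply_apply] at h4 hstep
      refine Prod.ext h4 (funext fun j => ?_)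
      have h5 := hstep j
      have h6 := P.counterStep_apply ((letterIndex R).symm ∘ w) t j
      simp only [Function.comp_apply] at h6
      simp only [run]
      rcases hop : (P.delta (P.cfg ((letterIndex R).symm ∘ w) t).1
        ((letterIndex R).symm (w t))).2 j with _ | _ | z
      · rw [hop] at h5 h6
        exact h5.2.trans h6.2.symm
      · rw [hop] at h5 h6
        exact h5.2.trans h6.2.symm
      · rw [hop] at h5 h6
        exact h5.trans h6.symm
  · rintro rfl
    refine ⟨⟨(P.mem_initial _).2 rfl, fun _ => rfl⟩, fun t => ⟨_, (P.mem_trans _ _ _ _).2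
      ⟨?_, rfl⟩, fun j => ?_⟩⟩
    · simp [run, cfg]
    · simpa [run] using P.counterStep_apply ((letterIndex R).symm ∘ w) t j

theorem exists_transGen_of_isAccepting {w π} (h : P.automaton.IsAccepting w π) {Q : ℤ → Prop}
    (hQ : (∀ x, Q x → x ≤ 0) ∨ ∀ x, Q x → 0 ≤ x)
    (hgood : ∀ᶠ k in atTop, Q (removeSilent (MonitorAutomaton.weights π) k)) :
    ∃ X Y, Relation.TransGen P.Next (P.restart, X) (P.restart, Y) := by
  have hterm := h.eventually_terminated hgood
  obtain rfl := (P.isRun_iff w π).1 h.1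
  obtain ⟨q, hq, hfreq⟩ := h.2.1
  refine P.exists_transGen_of_cfg _ (hfreq.mono fun t ht => ?_) hQ hterm
  have h1 := (P.mem_accepting q).1 hq
  rw [← ht] at h1
  simpa [run] using h1

theorem exists_isAccepting_of_transGen {X : Bool → ℕ}
    (h : Relation.TransGen P.Next (P.restart, X) (P.restart, X)) :
    ∃ w π, P.automaton.IsAccepting w π ∧ (∀ π', P.automaton.IsRun w π' → π' = π) ∧
      removeSilent (MonitorAutomaton.weights π) = fun _ => 0 := by
  obtain ⟨f, h0, hf, hfreq⟩ := exists_periodic h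
  have h0' : (f 0).1 = P.restart := by rw [h0]
  let a := Position.word f
  have ha : (letterIndex R).symm ∘ (letterIndex R ∘ a) = a := by
    funext t; simp
  refine ⟨letterIndex R ∘ a, P.run a, ⟨?_, ?_, ?_, ?_⟩, fun π' hπ' => ?_, ?_⟩
  · rw [isRun_iff, ha]
  · have h1 := frequently_isRestarted hf h0' (hfreq.mono fun i hi => by rw [hi])
    by_contra hno
    push Not at hno
    -- Acceptance asks for one state that recurs. As there are finitely many states, avoiding each
    -- accepting state eventually means avoiding all of them from some time on.
    have h2 : ∀ᶠ t in atTop, ∀ q ∈ P.automaton.accepting, (P.run a t).1 ≠ q := by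
      refine eventually_all.2 fun q => ?_
      by_cases hq : q ∈ P.automaton.accepting
      · filter_upwards [hno q hq] with t ht _ using ht
      · exact Eventually.of_forall fun t h => absurd h hq
    obtain ⟨t, ht1, ht2⟩ := (h1.and_eventually h2).exists
    exact ht2 _ ((P.mem_accepting _).2 (by simpa [run] using ht1)) rfl
  · exact frequently_activated hf h0'
  · intro t j _
    exact exists_terminated hf h0' t j
  · rw [(P.isRun_iff _ _).1 hπ', ha]
  · exact MonitorAutomaton.removeSilent_weights_eq_zero fun k j x h1 h2 =>
      terminated_word hf h0' h1 h2

/-- The numberings of letters and states are chosen once, independently of `n`. The lists are of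
fixed length, and only finitely many integer entries vary. -/
theorem computable_description {P : ℕ → RuleSystem C R}
    (hP : ∀ n, (P n).src = (P 0).src ∧ (P n).tgt = (P 0).tgt ∧ (P n).mul = (P 0).mul ∧
      (P n).den = (P 0).den ∧ (P n).restart = (P 0).restart)
    (hadd : ∀ r x, (Computable fun n => (P n).add r x) ∧ Computable fun n => -(P n).add r x) :
    Computable fun n => (P n).description := by
  classical
  have hstate : ∀ n s a, ((P n).delta s a).1 = ((P 0).delta s a).1 := by
    intro n s a
    obtain ⟨h1, h2, -⟩ := hP n
    rcases s with _ | ⟨pr, r, p, k⟩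
    · rfl
    rcases a with _ | r' | x
    · simp only [delta]; split_ifs <;> rfl
    · simp only [delta, h1, h2]
    · simp only [delta]; split_ifs <;> rfl
  have hop : ∀ s a j, Computable fun n => ((P n).delta s a).2 j := by
    intro s a j
    -- The fifth tick, for the counters of the current class, is the only place where `add` enters.
    by_cases hdep : ∃ pr r p k, s = some (pr, r, p, k) ∧ a = none ∧ k.val = 4 ∧ counterClass j = p
    · obtain ⟨pr, r, p, k, rfl, rfl, hk, hj⟩ := hdep
      have hj4 : ¬ j.val % 4 = 4 := by omega
      have h : ∀ n, ((P n).delta (some (pr, r, p, k)) none).2 j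
          = .add (counterSign j * (P n).add r (counterCoord j)) := by
        intro n; simp [delta, hk, hj, hj4]
      simp only [h]
      refine CounterOp.computable_add ?_
      rw [counterSign]
      split_ifs
      · simpa using (hadd r (counterCoord j)).1
      · simpa using (hadd r (counterCoord j)).2
    · have h : ∀ n, ((P n).delta s a).2 j = ((P 0).delta s a).2 j := by
        intro n
        obtain ⟨h1, h2, h3, h4, -⟩ := hP n
        rcases s with _ | ⟨pr, r, p, k⟩
        · rfl
        rcases a with _ | r' | x
        · simp only [delta]
          by_cases hk : k.val < 5
          · simp only [dif_pos hk]
            by_cases hj : counterClass j = p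
            · have hk4 : ¬ k.val = 4 := fun hk4 => hdep ⟨pr, r, p, k, rfl, rfl, hk4, hj⟩
              simp [hk4]
            · simp [hj]
          · simp only [dif_neg hk]
        · simp only [delta, h1, h2]
        · simp only [delta, h3, h4]
      simp only [h]
      exact Computable.const _
  have hinit : ∀ n, (P n).initState = (P 0).initState := fun n => by
    rw [initState, (hP n).2.2.2.2, initState]
  have hacc : ∀ n, (P n).IsRestarted = (P 0).IsRestarted := fun n => by
    unfold IsRestarted
    rw [(hP n).2.2.2.2]
  have hsymm : Primrec (AutomatonDescription.equivProd 8).symm :=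
    Primrec.of_equiv_symm (e := AutomatonDescription.equivProd 8)
  have htrans : Computable fun n => (P n).description.trans := by
    refine Computable.list_map_const (fun p => ?_) _
    simp only [hstate]
    exact (Computable.const _).pair ((Computable.const _).pair ((Computable.const _).pair
      (Computable.fin_pi fun j => hop p.1 p.2 j)))
  refine (hsymm.to_comp.comp ((Computable.const (Fintype.card (Letter R))).pair
    ((Computable.const (Fintype.card (BlockState R))).pair
      ((Computable.const (P 0).description.initial).pair
        (htrans.pair (Computable.const (P 0).description.accepting)))))).of_eq fun n => ?_
  have e1 : (P 0).description.initial = (P n).description.initial := by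
    simp only [description, hinit n]
  have e2 : (P 0).description.accepting = (P n).description.accepting := by
    simp only [description, hacc n]
  rw [e1, e2]
  rfl

end RuleSystem

/-! ### The reductions -/

theorem not_emptinessDecidable {f : ValueFunction} (h0 : f (fun _ => 0) = 0)
    (hf : ∀ s : ℕ → ℤ, f s < 1 → ∀ᶠ k in atTop, s k ≤ 0) : ¬ EmptinessDecidable f 8 := by
  rintro ⟨g, hg, hgq⟩
  obtain ⟨C, R, _, P, D, hP, hadd, hD1, hD2, hund⟩ := exists_ruleSystem_undecidable
  refine hund (ComputablePred.computable_iff.2 ⟨fun n => g ((P n).description, 0),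
    hg.comp ((RuleSystem.computable_description hP hadd).pair (Computable.const 0)), ?_⟩)
  funext n
  have hq : g ((P n).description, 0) = true ↔ (P n).automaton.Emptiness f 0 :=
    hgq ((P n).description, 0) (P n).automaton_isDeterministic
  refine propext (Iff.trans ?_ hq.symm)
  constructor
  · intro hn
    obtain ⟨X, hX⟩ := hD1 n hn
    obtain ⟨w, π, hacc, -, hval⟩ := (P n).exists_isAccepting_of_transGen hX
    refine ⟨w, (iInf₂_le π hacc).trans ?_⟩
    rw [hval, h0]
    simp
  · rintro ⟨w, hw⟩
    -- A strict bound on the infimum passes to some run. The bound 1 loses nothing, as the counters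
    -- are integers.
    have hlt : MonitorAutomaton.value f (P n).automaton w < 1 :=
      lt_of_le_of_lt hw (by simp)
    obtain ⟨π, hπ⟩ := iInf_lt_iff.1 hlt
    obtain ⟨hacc, hlt⟩ := iInf_lt_iff.1 hπ
    obtain ⟨X, Y, h⟩ := (P n).exists_transGen_of_isAccepting hacc (Q := fun x => x ≤ 0)
      (.inl fun _ h => h) (hf _ hlt)
    exact hD2 n X Y h

/-- Halting corresponds to the failure of universality, so the answer of the decision procedure is
negated. -/
theorem not_universalityDecidable {f : ValueFunction} (h0 : f (fun _ => 0) = 0)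
    (hf : ∀ s : ℕ → ℤ, -1 < f s → ∀ᶠ k in atTop, 0 ≤ s k) : ¬ UniversalityDecidable f 8 := by
  rintro ⟨g, hg, hgq⟩
  obtain ⟨C, R, _, P, D, hP, hadd, hD1, hD2, hund⟩ := exists_ruleSystem_undecidable
  refine hund (ComputablePred.computable_iff.2 ⟨fun n => !g ((P n).description, -1),
    Primrec.not.to_comp.comp
      (hg.comp ((RuleSystem.computable_description hP hadd).pair (Computable.const (-1)))), ?_⟩)
  funext n
  have hq : g ((P n).description, -1) = true ↔ (P n).automaton.Universality f (-1) :=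
    hgq ((P n).description, -1) (P n).automaton_isDeterministic
  have key : D n ↔ ¬ (P n).automaton.Universality f (-1) := by
    constructor
    · intro hn huniv
      obtain ⟨X, hX⟩ := hD1 n hn
      obtain ⟨w, π, hacc, huniq, hval⟩ := (P n).exists_isAccepting_of_transGen hX
      have hle := huniv w ⟨π, hacc⟩
      -- A lower bound on the infimum concerns all accepting runs, hence the appeal to uniqueness of
      -- the run.
      have hge : (0 : EReal) ≤ MonitorAutomaton.value f (P n).automaton w := by
        refine le_iInf₂ fun π' hπ' => ?_
        rw [huniq π' hπ'.1, hval, h0]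
      have := hge.trans hle
      norm_cast at this
    · intro huniv
      simp only [MonitorAutomaton.Universality, not_forall, not_le] at huniv
      obtain ⟨w, ⟨π, hacc⟩, hlt⟩ := huniv
      have hlt' := hlt.trans_le (iInf₂_le π hacc)
      obtain ⟨X, Y, h⟩ := (P n).exists_transGen_of_isAccepting hacc (Q := fun x => 0 ≤ x)
        (.inr fun _ h => h) (hf _ (by simpa using hlt'))
      exact hD2 n X Y h
  refine propext (key.trans ?_)
  rw [← hq]
  simp

theorem le_zero_of_coe_lt_one {x : ℤ} (h : ((x : ℝ) : EReal) < 1) : x ≤ 0 := by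
  have : (x : ℝ) < 1 := by exact_mod_cast h
  have : x < 1 := by exact_mod_cast this
  omega

theorem zero_le_of_neg_one_lt_coe {x : ℤ} (h : (-1 : EReal) < ((x : ℝ) : EReal)) : 0 ≤ x := by
  rw [show (-1 : EReal) = (((-1 : ℤ) : ℝ) : EReal) by simp] at h
  have := Int.cast_lt.1 (EReal.coe_lt_coe_iff.1 h)
  omega

theorem mainTheorem9 :
    (¬ EmptinessDecidable ValueFunction.Sup 8 ∧ ¬ EmptinessDecidable ValueFunction.LimSup 8) ∧
      (¬ UniversalityDecidable ValueFunction.Inf 8 ∧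
        ¬ UniversalityDecidable ValueFunction.LimInf 8) := by
  refine ⟨⟨not_emptinessDecidable (by simp [ValueFunction.Sup]) fun s hs => ?_,
    not_emptinessDecidable (by simp [ValueFunction.LimSup]) fun s hs => ?_⟩,
    ⟨not_universalityDecidable (by simp [ValueFunction.Inf]) fun s hs => ?_,
    not_universalityDecidable (by simp [ValueFunction.LimInf]) fun s hs => ?_⟩⟩
  · exact Eventually.of_forall fun k => le_zero_of_coe_lt_one
      ((le_iSup (fun k => ((s k : ℝ) : EReal)) k).trans_lt hs)
  · exact (eventually_lt_of_limsup_lt hs).mono fun k hk => le_zero_of_coe_lt_one hk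
  · exact Eventually.of_forall fun k => zero_le_of_neg_one_lt_coe
      (hs.trans_le (iInf_le (fun k => ((s k : ℝ) : EReal)) k))
  · exact (eventually_lt_of_lt_liminf hs).mono fun k hk => zero_le_of_neg_one_lt_coe hk
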